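/- Let $M$ be a smooth finite-dimensional manifold without boundary (not necessarily closed), and let $(\mathtt g,\sigma)$ be a magnetic system on $M$, that is, a smooth Riemannian metric $\mathtt g=\langle\cdot,\cdot\rangle$ and a smooth closed $2$-form $\sigma$. Let $\Omega$ be the Lorentz force, the endomorphism of $TM$ with $\sigma(v,w)=\langle v,\Omega(w)\rangle$; let $\nabla$, $\frac{\mathrm D}{\mathrm dt}$ be the Levi-Civita connection and the covariant derivative it induces along curves, and let $R(u,v)w=\nabla_u\nabla_vw-\nabla_v\nabla_uw-\nabla_{[u,v]}w$. For $s>0$, a unit tangent vector $v$ and $w\in v^\perp$, put $$(M^\Omega_s)_v(w)=s^2R(w,v)v-s(\nabla_w\Omega)(v)+\tfrac s2\big((\nabla_v\Omega)(w)-\langle(\nabla_v\Omega)(w),v\rangle v\big)+\tfrac34\langle w,\Omega(v)\rangle\Omega(v)-\tfrac14\Omega^2(w)-\tfrac14\langle\Omega(w),\Omega(v)\rangle v,$$ and, for unit $w\perp v$, let $(\mathrm{sec}^\Omega_s)_v(w)=\langle(M^\Omega_s)_v(w),w\rangle$ be the magnetic sectional curvature at level $s$. If $s>0$ is such that $(\mathrm{sec}^\Omega_s)_v(w)\le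 0$ for all orthonormal pairs $v,w$ of tangent vectors at all points of $M$, then the magnetic flow of $(\mathtt g,\sigma)$ on the $s$-sphere bundle $\Sigma_s=\{v\in TM:\|v\|=s\}$ is without conjugate points, in the following sense. Let $I\subseteq\mathbb R$ be any open interval containing $0$, and let $\gamma\colon I\to M$ be any $(\mathtt g,\sigma)$-geodesic, i.e. a smooth solution of $\frac{\mathrm D\dot\gamma}{\mathrm dt}=\Omega(\dot\gamma)$, with $\|\dot\gamma\|=s$. Then for no $\tau\in I$ with $\tau\neq0$ does there exist a smooth vector field $J$ along $\gamma$, not identically zero on $I$, such that $$\frac{\mathrm D^2J}{\mathrm dt^2}+R(J,\dot\gamma)\dot\gamma=(\nabla_J\Omega)(\dot\gamma)+\Omega\Big(\frac{\mathrm DJ}{\mathrm dt}\Big),\qquad\Big\langle\frac{\mathrm DJ}{\mathrm dt},\dot\gamma\Big\rangle=0\quad\text{on }I,$$ $J(0)=0$, and $J(\tau)$ is a multiple of $\dot\gamma(\tau)$. -/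

import Mathlib

open Bundle Set
open scoped Manifold ContDiff Topology

noncomputable section

/-! ## Riemannian calculus in an open piece of the model vector space

A "metric field" is a map `G : E → E →L[ℝ] E →L[ℝ] ℝ`; the value `G p u w` is the inner product of
`u` and `w` at the point `p`. -/

namespace LocalGeometry

variable {E : Type*} [NormedAddCommGroup E] [NormedSpace ℝ E]

/-- The Christoffel map `Γ_p(u, w)` of the Levi-Civita connection of a metric field `G`:
the vector such that, for all `z`,
`G_p(Γ_p(u, w), z) = (1/2) * (∂_u G(w, z) + ∂_w G(u, z) - ∂_z G(u, w))`. -/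
def christoffel (G : E → E →L[ℝ] E →L[ℝ] ℝ) (p u w : E) : E :=
  (G p).inverse ((1 / 2 : ℝ) •
    (fderiv ℝ G p u w + fderiv ℝ G p w u - ((fderiv ℝ G p).flip u).flip w))

/-- The Riemann curvature tensor
`R(u, v) w = ∇_u ∇_v w - ∇_v ∇_u w` (for constant vector fields `u`, `v`, `w`) at `p`. -/
def curvature (G : E → E →L[ℝ] E →L[ℝ] ℝ) (p u v w : E) : E :=
  fderiv ℝ (fun q => christoffel G q v w) p u - fderiv ℝ (fun q => christoffel G q u w) p v
    + christoffel G p u (christoffel G p v w) - christoffel G p v (christoffel G p u w)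

/-- The covariant derivative `(∇_u A)(w) = ∇_u (A w) - A (∇_u w)` at `p` of a field `A` of
endomorphisms. -/
def nablaEnd (G : E → E →L[ℝ] E →L[ℝ] ℝ) (A : E → E →L[ℝ] E) (p u w : E) : E :=
  fderiv ℝ A p u w + christoffel G p u (A p w) - A p (christoffel G p u w)

/-- The exterior derivative `dσ(u, v, w)` at `p` of a field `σ` of alternating bilinear forms. -/
def extDerivTwo (σ : E → E →L[ℝ] E →L[ℝ] ℝ) (p u v w : E) : ℝ :=
  fderiv ℝ σ p u v w + fderiv ℝ σ p v w u + fderiv ℝ σ p w u v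

end LocalGeometry

/-! ## Coordinates on a manifold -/

section Coordinates

variable {E : Type*} [NormedAddCommGroup E] [NormedSpace ℝ E]
  {M : Type*} [TopologicalSpace M] [ChartedSpace E M]

/-- The differential at `y` of the preferred chart centred at `x`: it sends a tangent vector at `y`
to its coordinates. It is invertible when `y` lies in the domain of that chart. -/
def chartDiff (x y : M) : TangentSpace 𝓘(ℝ, E) y →L[ℝ] E :=
  mfderiv 𝓘(ℝ, E) 𝓘(ℝ, E) (extChartAt 𝓘(ℝ, E) x) y

/-- The expression, in the preferred chart centred at `x`, of a field `b` of bilinear forms. -/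
def chartBilin
    (b : ∀ y : M, TangentSpace 𝓘(ℝ, E) y →L[ℝ] TangentSpace 𝓘(ℝ, E) y →L[ℝ] ℝ) (x : M) :
    E → E →L[ℝ] E →L[ℝ] ℝ := fun p =>
  let y := (extChartAt 𝓘(ℝ, E) x).symm p
  (ContinuousLinearMap.precomp ℝ (chartDiff x y).inverse).comp
    ((b y).comp (chartDiff x y).inverse)

/-- The expression, in the preferred chart centred at `x`, of a field `A` of endomorphisms. -/
def chartEnd
    (A : ∀ y : M, TangentSpace 𝓘(ℝ, E) y →L[ℝ] TangentSpace 𝓘(ℝ, E) y) (x : M) :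
    E → E →L[ℝ] E := fun p =>
  let y := (extChartAt 𝓘(ℝ, E) x).symm p
  (chartDiff x y).comp ((A y).comp (chartDiff x y).inverse)

/-- The velocity of a curve `γ` at time `t`. -/
def velocity (γ : ℝ → M) (t : ℝ) : TangentSpace 𝓘(ℝ, E) (γ t) :=
  mfderiv 𝓘(ℝ, ℝ) 𝓘(ℝ, E) γ t (1 : ℝ)

end Coordinates

/-! ## Magnetic systems -/

/-- A magnetic system on a manifold `M` without boundary: a smooth Riemannian metric together with
a smooth closed `2`-form. -/
structure MagneticSystem (E : Type*) [NormedAddCommGroup E] [NormedSpace ℝ E]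
    (M : Type*) [TopologicalSpace M] [ChartedSpace E M] [IsManifold 𝓘(ℝ, E) ∞ M] where
  /-- The Riemannian metric. -/
  metric : ContMDiffRiemannianMetric 𝓘(ℝ, E) ∞ E (fun x : M => TangentSpace 𝓘(ℝ, E) x)
  /-- The magnetic form. -/
  form : ∀ x : M, TangentSpace 𝓘(ℝ, E) x →L[ℝ] TangentSpace 𝓘(ℝ, E) x →L[ℝ] ℝ
  form_self : ∀ (x : M) (v : TangentSpace 𝓘(ℝ, E) x), form x v v = 0
  form_smooth : ContMDiff 𝓘(ℝ, E) (𝓘(ℝ, E).prod 𝓘(ℝ, E →L[ℝ] E →L[ℝ] ℝ)) ∞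
    (fun x : M => TotalSpace.mk' (E →L[ℝ] E →L[ℝ] ℝ)
      (E := fun x : M => TangentSpace 𝓘(ℝ, E) x →L[ℝ] TangentSpace 𝓘(ℝ, E) x →L[ℝ] ℝ)
      x (form x))
  form_closed : ∀ (x : M) (u v w : E),
    LocalGeometry.extDerivTwo (chartBilin form x) (extChartAt 𝓘(ℝ, E) x x) u v w = 0

namespace MagneticSystem

variable {E : Type*} [NormedAddCommGroup E] [NormedSpace ℝ E]
  {M : Type*} [TopologicalSpace M] [ChartedSpace E M] [IsManifold 𝓘(ℝ, E) ∞ M]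
  (S : MagneticSystem E M)

/-- The Lorentz force `Ω`, characterized by `σ(v, w) = ⟨v, Ω(w)⟩`; see `form_eq_inner_lorentz`. -/
def lorentz (x : M) : TangentSpace 𝓘(ℝ, E) x →L[ℝ] TangentSpace 𝓘(ℝ, E) x :=
  -((S.metric.inner x).inverse.comp (S.form x))

lemma metric_isInvertible [FiniteDimensional ℝ E] (x : M) : (S.metric.inner x).IsInvertible := by
  let B : E →L[ℝ] E →L[ℝ] ℝ := S.metric.inner x
  have hinj : Function.Injective B := by
    refine (injective_iff_map_eq_zero B).2 fun v hv => ?_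
    by_contra hne
    have h := S.metric.pos x v hne
    have h0 : S.metric.inner x v v = 0 := congrArg (fun f : E →L[ℝ] ℝ => f v) hv
    exact absurd h0 h.ne'
  have hdim : Module.finrank ℝ E = Module.finrank ℝ (E →L[ℝ] ℝ) := by
    rw [← (LinearMap.toContinuousLinearMap (𝕜 := ℝ) (E := E) (F' := ℝ)).finrank_eq]
    exact (Subspace.dual_finrank_eq (K := ℝ) (V := E)).symm
  exact ⟨(LinearEquiv.ofInjectiveOfFinrankEq B.toLinearMap hinj hdim).toContinuousLinearEquiv, rfl⟩

lemma form_eq_inner_lorentz [FiniteDimensional ℝ E] (x : M) (v w : TangentSpace 𝓘(ℝ, E) x) :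
    S.form x v w = S.metric.inner x v (S.lorentz x w) := by
  have hskew : S.form x w v = -S.form x v w := by
    have h := S.form_self x (v + w)
    simp only [map_add, add_apply, S.form_self] at h
    linarith
  have h : S.metric.inner x ((S.metric.inner x).inverse (S.form x w)) = S.form x w := by
    obtain ⟨e, he⟩ := S.metric_isInvertible x
    rw [← he]
    simp
  rw [S.metric.symm]
  simp [lorentz, h, hskew]

/-- The Riemann curvature tensor `R(u, v) w` of the metric. -/
def curvature (x : M) (u v w : TangentSpace 𝓘(ℝ, E) x) : TangentSpace 𝓘(ℝ, E) x :=
  (chartDiff x x).inverse (LocalGeometry.curvature (chartBilin S.metric.inner x)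
    (extChartAt 𝓘(ℝ, E) x x) (chartDiff x x u) (chartDiff x x v) (chartDiff x x w))

/-- The covariant derivative `(∇_u Ω)(w)` of the Lorentz force. -/
def nablaLorentz (x : M) (u w : TangentSpace 𝓘(ℝ, E) x) : TangentSpace 𝓘(ℝ, E) x :=
  (chartDiff x x).inverse (LocalGeometry.nablaEnd (chartBilin S.metric.inner x)
    (chartEnd S.lorentz x) (extChartAt 𝓘(ℝ, E) x x) (chartDiff x x u) (chartDiff x x w))

/-- The Levi-Civita covariant derivative `DV/dt` at time `t` of a vector field `V` along the
curve `γ`, computed in the preferred chart centred at `γ t`. -/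
def covDeriv (γ : ℝ → M) (V : ∀ t : ℝ, TangentSpace 𝓘(ℝ, E) (γ t)) (t : ℝ) :
    TangentSpace 𝓘(ℝ, E) (γ t) :=
  (chartDiff (γ t) (γ t)).inverse
    (deriv (fun r => chartDiff (γ t) (γ r) (V r)) t
      + LocalGeometry.christoffel (chartBilin S.metric.inner (γ t)) (extChartAt 𝓘(ℝ, E) (γ t) (γ t))
          (deriv (fun r => extChartAt 𝓘(ℝ, E) (γ t) (γ r)) t)
          (chartDiff (γ t) (γ t) (V t)))

/-! ### Magnetic curvature -/

/-- The operator `(R^Ω_s)_v`. -/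
def curvR (s : ℝ) (x : M) (v w : TangentSpace 𝓘(ℝ, E) x) : TangentSpace 𝓘(ℝ, E) x :=
  s ^ 2 • S.curvature x w v v - s • S.nablaLorentz x w v
    + (s / 2) • (S.nablaLorentz x v w - S.metric.inner x (S.nablaLorentz x v w) v • v)

/-- The operator `(A^Ω)_v`. -/
def curvA (x : M) (v w : TangentSpace 𝓘(ℝ, E) x) : TangentSpace 𝓘(ℝ, E) x :=
  (3 / 4 * S.metric.inner x w (S.lorentz x v) : ℝ) • S.lorentz x v
    - (1 / 4 : ℝ) • S.lorentz x (S.lorentz x w)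
    - (1 / 4 * S.metric.inner x (S.lorentz x w) (S.lorentz x v) : ℝ) • v

/-- The magnetic curvature operator `(M^Ω_s)_v` at level `s`. -/
def magneticCurvature (s : ℝ) (x : M) (v w : TangentSpace 𝓘(ℝ, E) x) : TangentSpace 𝓘(ℝ, E) x :=
  S.curvR s x v w + S.curvA x v w

/-- The magnetic sectional curvature `(sec^Ω_s)_v(w)` at level `s`; it is meaningful for unit
vectors `v` and `w` orthogonal to each other. -/
def magneticSec (s : ℝ) (x : M) (v w : TangentSpace 𝓘(ℝ, E) x) : ℝ :=
  S.metric.inner x (S.magneticCurvature s x v w) w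

/-! ### Magnetic geodesics, Jacobi fields, conjugate points -/

/-- `γ`, restricted to `I`, is a magnetic geodesic: a smooth solution of `Dγ'/dt = Ω(γ')`. -/
structure IsGeodesicOn (γ : ℝ → M) (I : Set ℝ) : Prop where
  smooth : ContMDiffOn 𝓘(ℝ, ℝ) 𝓘(ℝ, E) ∞ γ I
  equation : ∀ t ∈ I, S.covDeriv γ (velocity γ) t = S.lorentz (γ t) (velocity γ t)

/-- `J`, restricted to `I`, is a magnetic Jacobi field along `γ`: a smooth vector field with
`D²J/dt² + R(J, γ')γ' = (∇_J Ω)(γ') + Ω(DJ/dt)`. -/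
structure IsJacobiOn (γ : ℝ → M) (I : Set ℝ) (J : ∀ t : ℝ, TangentSpace 𝓘(ℝ, E) (γ t)) :
    Prop where
  smooth : ContMDiffOn 𝓘(ℝ, ℝ) (𝓘(ℝ, E).prod 𝓘(ℝ, E)) ∞
    (fun t => (⟨γ t, J t⟩ : TangentBundle 𝓘(ℝ, E) M)) I
  equation : ∀ t ∈ I,
    S.covDeriv γ (S.covDeriv γ J) t + S.curvature (γ t) (J t) (velocity γ t) (velocity γ t)
      = S.nablaLorentz (γ t) (J t) (velocity γ t) + S.lorentz (γ t) (S.covDeriv γ J t)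

/-- A vector field `J` along `γ` is normal on `I` if `⟨DJ/dt, γ'⟩ = 0`. -/
def IsNormalOn (γ : ℝ → M) (I : Set ℝ) (J : ∀ t : ℝ, TangentSpace 𝓘(ℝ, E) (γ t)) : Prop :=
  ∀ t ∈ I, S.metric.inner (γ t) (S.covDeriv γ J t) (velocity γ t) = 0

/-- `γ τ` is conjugate to `γ 0` along the magnetic geodesic `γ` defined on `I`: there is a normal
Jacobi field, not identically zero, vanishing at time `0` and proportional to the velocity of `γ`
at time `τ`. -/
def IsConjugateAlong (γ : ℝ → M) (I : Set ℝ) (τ : ℝ) : Prop :=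
  ∃ J : ∀ t : ℝ, TangentSpace 𝓘(ℝ, E) (γ t),
    S.IsJacobiOn γ I J ∧ S.IsNormalOn γ I J ∧ (∃ t ∈ I, J t ≠ 0) ∧
      J 0 = 0 ∧ ∃ c : ℝ, J τ = c • velocity γ τ

/-- The magnetic flow on the `s`-sphere bundle is without conjugate points: for each magnetic
geodesic `γ` of speed `s`, defined on an open interval `I` containing `0` (the flow may be
incomplete), no point `γ τ` with `0 ≠ τ ∈ I` is conjugate to `γ 0` along `γ`. -/
def WithoutConjugatePoints (s : ℝ) : Prop :=
  ∀ (γ : ℝ → M) (I : Set ℝ), IsOpen I → I.OrdConnected → (0 : ℝ) ∈ I →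
    S.IsGeodesicOn γ I →
    (∀ t ∈ I, √(S.metric.inner (γ t) (velocity γ t) (velocity γ t)) = s) →
    ∀ τ ∈ I, τ ≠ 0 → ¬ S.IsConjugateAlong γ I τ

end MagneticSystem

end

/-! Write X = γ', K = DJ/dt and J = W + fX with W ⊥ X, so that f = ⟨J,X⟩/s² and |W|² = |J|² −
⟨J,X⟩²/s². Put a = ⟨W,ΩX⟩. Normality of J and the geodesic equation give f' = a/s², hence DW/dt = K
− (a/s²)X − fΩX. Completing the square with Y = DW/dt − ½ΩW turns the Jacobi equation into ½(|W|²)''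
= |Y|² − a²/s² − (⟨R(W,X)X,W⟩ − ⟨(∇_WΩ)X,W⟩ + ¼|ΩW|²). For W ≠ 0 the bracket plus ¾a²/s² is |W|²
times the magnetic sectional curvature of the normalised pair, so it is nonpositive and the right
side is at least |Y|² − a²/(4s²). As ⟨Y,X⟩ = −a/2 and |X| = s, Cauchy–Schwarz makes this nonnegative
(`second_variation_nonneg`), and |W|² is convex (`convexOn_normal_component`).

A nonnegative convex function vanishing at 0 and τ vanishes in between. There J is parallel to X, so
⟨J,X⟩' = ⟨J,ΩX⟩ = 0; since J(0) = 0, J vanishes between 0 and τ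
(`eq_zero_of_normal_component_eq_zero`). Uniqueness for the linear Jacobi equation then gives J = 0
on all of I (`eq_zero_of_isJacobiOn`).

Curvature, ∇Ω and D/dt are defined at each point through the chart centred at that point, whereas
differentiation along a curve needs one fixed chart. The two are reconciled by naturality:
transition maps are local isometries of the coordinate metrics, and all three objects are natural
under these. -/

noncomputable section

set_option maxSynthPendingDepth 3

/-! ### Levi-Civita calculus of a metric field on an open set -/

namespace LocalGeometry

variable {E : Type*} [NormedAddCommGroup E] [NormedSpace ℝ E]

/-- The Christoffel symbols of the first kind, as a trilinear form. -/
def christoffelForm (G : E → E →L[ℝ] E →L[ℝ] ℝ) (p : E) : E →L[ℝ] E →L[ℝ] E →L[ℝ] ℝ :=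
  (1 / 2 : ℝ) • (fderiv ℝ G p + (fderiv ℝ G p).flip
    - (ContinuousLinearMap.flipₗᵢ ℝ E E ℝ).toContinuousLinearEquiv.toContinuousLinearMap.comp
      (fderiv ℝ G p).flip)

/-- The Christoffel map, as a continuous bilinear map. -/
def christoffelCLM (G : E → E →L[ℝ] E →L[ℝ] ℝ) (p : E) : E →L[ℝ] E →L[ℝ] E :=
  (ContinuousLinearMap.compL ℝ E (E →L[ℝ] ℝ) E (G p).inverse).comp (christoffelForm G p)

lemma christoffelCLM_apply (G : E → E →L[ℝ] E →L[ℝ] ℝ) (p u w : E) :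
    christoffelCLM G p u w = christoffel G p u w := by
  rfl

lemma christoffel_add_left (G : E → E →L[ℝ] E →L[ℝ] ℝ) (p u v w : E) :
    christoffel G p (u + v) w = christoffel G p u w + christoffel G p v w := by
  simp [← christoffelCLM_apply]

lemma christoffel_smul_left (G : E → E →L[ℝ] E →L[ℝ] ℝ) (c : ℝ) (p u w : E) :
    christoffel G p (c • u) w = c • christoffel G p u w := by
  simp [← christoffelCLM_apply]

lemma christoffel_smul_right (G : E → E →L[ℝ] E →L[ℝ] ℝ) (c : ℝ) (p u w : E) :
    christoffel G p u (c • w) = c • christoffel G p u w := by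
  simp [← christoffelCLM_apply]

/-- A field of bilinear forms which is smooth, symmetric and nondegenerate on an open set. -/
structure IsMetricOn (G : E → E →L[ℝ] E →L[ℝ] ℝ) (U : Set E) : Prop where
  isOpen : IsOpen U
  contDiffOn : ContDiffOn ℝ ∞ G U
  isInvertible : ∀ p ∈ U, (G p).IsInvertible
  symm : ∀ p ∈ U, ∀ u w, G p u w = G p w u

lemma inverse_apply_self_left {b : E →L[ℝ] E →L[ℝ] ℝ} (hb : b.IsInvertible) (l : E →L[ℝ] ℝ) :
    b (b.inverse l) = l := by
  obtain ⟨e, rfl⟩ := hb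
  simp

lemma eq_of_forall_apply_eq {b : E →L[ℝ] E →L[ℝ] ℝ} (hb : b.IsInvertible) {u v : E}
    (h : ∀ z, b u z = b v z) : u = v := by
  obtain ⟨e, rfl⟩ := hb
  exact e.injective (ContinuousLinearMap.ext h)

namespace IsMetricOn

variable {G : E → E →L[ℝ] E →L[ℝ] ℝ} {U : Set E} {p : E}

lemma contDiffAt (h : IsMetricOn G U) (hp : p ∈ U) : ContDiffAt ℝ ∞ G p :=
  h.contDiffOn.contDiffAt (h.isOpen.mem_nhds hp)

lemma differentiableAt (h : IsMetricOn G U) (hp : p ∈ U) : DifferentiableAt ℝ G p :=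
  (h.contDiffAt hp).differentiableAt (by simp)

lemma fderiv_apply_apply (h : IsMetricOn G U) (hp : p ∈ U) (u v w : E) :
    fderiv ℝ (fun q => G q v w) p u = fderiv ℝ G p u v w := by
  have h1 := ((h.differentiableAt hp).hasFDerivAt.clm_apply (hasFDerivAt_const v p)).clm_apply
    (hasFDerivAt_const w p)
  rw [h1.fderiv]
  simp

lemma fderiv_symm (h : IsMetricOn G U) (hp : p ∈ U) (u v w : E) :
    fderiv ℝ G p u v w = fderiv ℝ G p u w v := by
  rw [← h.fderiv_apply_apply hp, ← h.fderiv_apply_apply hp]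
  congr 1
  apply Filter.EventuallyEq.fderiv_eq
  filter_upwards [h.isOpen.mem_nhds hp] with q hq using h.symm q hq v w

lemma apply_christoffel (h : IsMetricOn G U) (hp : p ∈ U) (u w z : E) :
    G p (christoffel G p u w) z
      = (1 / 2) * (fderiv ℝ G p u w z + fderiv ℝ G p w u z - fderiv ℝ G p z u w) := by
  rw [christoffel, inverse_apply_self_left (h.isInvertible p hp)]
  simp

/-- The connection is metric: in the sum of the two Koszul formulas all derivatives except the one
along `u` cancel in pairs. -/
lemma compatible (h : IsMetricOn G U) (hp : p ∈ U) (u v w : E) :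
    fderiv ℝ G p u v w = G p (christoffel G p u v) w + G p v (christoffel G p u w) := by
  rw [h.symm p hp v, h.apply_christoffel hp, h.apply_christoffel hp, h.fderiv_symm hp v u w,
    h.fderiv_symm hp u w v, h.fderiv_symm hp w u v]
  ring

lemma contDiffOn_fderiv (h : IsMetricOn G U) : ContDiffOn ℝ ∞ (fderiv ℝ G) U :=
  h.contDiffOn.fderiv_of_isOpen h.isOpen (by simp)

-- Inversion is smooth at invertible maps, and the remaining operations are continuous linear or
-- bilinear. The bundled form of Γ lets its derivative be taken once, as a linear map, and evaluated
-- afterwards.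
set_option synthInstance.maxHeartbeats 100000 in
lemma contDiffOn_christoffelCLM [CompleteSpace E] (h : IsMetricOn G U) :
    ContDiffOn ℝ ∞ (christoffelCLM G) U := by
  have hflip : ContDiffOn ℝ ∞ (fun q => (fderiv ℝ G q).flip) U :=
    (ContinuousLinearMap.flipₗᵢ ℝ E E (E →L[ℝ] ℝ)).toContinuousLinearEquiv.contDiff.comp_contDiffOn
      h.contDiffOn_fderiv
  have hform : ContDiffOn ℝ ∞ (christoffelForm G) U := by
    refine ContDiffOn.const_smul _ ((h.contDiffOn_fderiv.add hflip).sub ?_)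
    exact contDiffOn_const.clm_comp hflip
  have hinv : ContDiffOn ℝ ∞ (fun q => (G q).inverse) U := fun q hq =>
    (h.isInvertible q hq).contDiffAt_map_inverse.comp_contDiffWithinAt q (h.contDiffOn q hq)
  exact ((ContinuousLinearMap.compL ℝ E (E →L[ℝ] ℝ) E).contDiff.comp_contDiffOn hinv).clm_comp hform

lemma hasFDerivAt_christoffelCLM [CompleteSpace E] (h : IsMetricOn G U) (hp : p ∈ U) :
    HasFDerivAt (christoffelCLM G) (fderiv ℝ (christoffelCLM G) p) p :=
  ((h.contDiffOn_christoffelCLM.contDiffAt (h.isOpen.mem_nhds hp)).differentiableAt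
    (by simp)).hasFDerivAt

lemma fderiv_christoffel [CompleteSpace E] (h : IsMetricOn G U) (hp : p ∈ U) (u v w : E) :
    fderiv ℝ (fun q => christoffel G q v w) p u = fderiv ℝ (christoffelCLM G) p u v w := by
  have h1 := ((h.hasFDerivAt_christoffelCLM hp).clm_apply (hasFDerivAt_const v p)).clm_apply
    (hasFDerivAt_const w p)
  refine (congrArg (fun f => f u) h1.fderiv).trans ?_
  simp

lemma curvature_eq [CompleteSpace E] (h : IsMetricOn G U) (hp : p ∈ U) (u v w : E) :
    curvature G p u v w = fderiv ℝ (christoffelCLM G) p u v w - fderiv ℝ (christoffelCLM G) p v u w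
      + christoffelCLM G p u (christoffelCLM G p v w)
      - christoffelCLM G p v (christoffelCLM G p u w) := by
  simp only [curvature, h.fderiv_christoffel hp, christoffelCLM_apply]

/-- Differentiate the identity G(Aw, w) = 0 for constant `w`, and absorb the derivative of G by
metric compatibility. -/
lemma nablaEnd_skew (h : IsMetricOn G U) (hp : p ∈ U) {A : E → E →L[ℝ] E}
    (hA : DifferentiableAt ℝ A p) (hskew : ∀ q ∈ U, ∀ v w, G q (A q v) w = -G q v (A q w))
    (u w : E) : G p (nablaEnd G A p u w) w = 0 := by
  have hG := (h.differentiableAt hp).hasFDerivAt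
  have h1 : HasFDerivAt (fun q => G q (A q w) w) _ p :=
    (hG.clm_apply (hA.hasFDerivAt.clm_apply (hasFDerivAt_const w p))).clm_apply
      (hasFDerivAt_const w p)
  have h2 : (fun q => G q (A q w) w) =ᶠ[𝓝 p] fun _ => 0 := by
    filter_upwards [h.isOpen.mem_nhds hp] with q hq
    have := hskew q hq w w
    rw [h.symm q hq w] at this
    linarith
  have h3 := congrArg (fun f => f u)
    (h1.unique ((hasFDerivAt_const (0 : ℝ) p).congr_of_eventuallyEq h2))
  simp [h.compatible hp] at h3
  have h4 := hskew p hp (christoffel G p u w) w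
  simp only [nablaEnd, map_add, map_sub, add_apply,
    sub_apply]
  rw [h.symm p hp (A p w) (christoffel G p u w)] at h3
  linarith

end IsMetricOn

lemma nablaEnd_add_left (G : E → E →L[ℝ] E →L[ℝ] ℝ) (A : E → E →L[ℝ] E) (p u v w : E) :
    nablaEnd G A p (u + v) w = nablaEnd G A p u w + nablaEnd G A p v w := by
  simp only [nablaEnd, map_add, christoffel_add_left, add_apply]
  abel

lemma nablaEnd_smul_left (G : E → E →L[ℝ] E →L[ℝ] ℝ) (A : E → E →L[ℝ] E) (c : ℝ) (p u w : E) :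
    nablaEnd G A p (c • u) w = c • nablaEnd G A p u w := by
  simp only [nablaEnd, map_smul, christoffel_smul_left, smul_apply, smul_add,
    smul_sub]

lemma nablaEnd_smul_right (G : E → E →L[ℝ] E →L[ℝ] ℝ) (A : E → E →L[ℝ] E) (c : ℝ) (p u w : E) :
    nablaEnd G A p u (c • w) = c • nablaEnd G A p u w := by
  simp only [nablaEnd, map_smul, christoffel_smul_right, smul_add, smul_sub]

/-! ### Naturality of connection, curvature and ∇A under local isometries -/

/-- A local isometry between two metric fields. -/
structure IsIsometryOn (G G' : E → E →L[ℝ] E →L[ℝ] ℝ) (φ : E → E) (U U' : Set E) : Prop where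
  metric : IsMetricOn G U
  metric' : IsMetricOn G' U'
  contDiffOn : ContDiffOn ℝ ∞ φ U
  mapsTo : MapsTo φ U U'
  surjective : ∀ p ∈ U, Function.Surjective (fderiv ℝ φ p)
  pullback : ∀ p ∈ U, ∀ u w, G p u w = G' (φ p) (fderiv ℝ φ p u) (fderiv ℝ φ p w)

namespace IsIsometryOn

variable {G G' : E → E →L[ℝ] E →L[ℝ] ℝ} {φ : E → E} {U U' : Set E} {p : E}

lemma hasFDerivAt (h : IsIsometryOn G G' φ U U') (hp : p ∈ U) :
    HasFDerivAt φ (fderiv ℝ φ p) p :=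
  ((h.contDiffOn.contDiffAt (h.metric.isOpen.mem_nhds hp)).differentiableAt (by simp)).hasFDerivAt

lemma contDiffOn_fderiv (h : IsIsometryOn G G' φ U U') : ContDiffOn ℝ ∞ (fderiv ℝ φ) U :=
  h.contDiffOn.fderiv_of_isOpen h.metric.isOpen (by simp)

lemma hasFDerivAt_fderiv (h : IsIsometryOn G G' φ U U') (hp : p ∈ U) :
    HasFDerivAt (fderiv ℝ φ) (fderiv ℝ (fderiv ℝ φ) p) p :=
  ((h.contDiffOn_fderiv.contDiffAt (h.metric.isOpen.mem_nhds hp)).differentiableAt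
    (by simp)).hasFDerivAt

lemma hasFDerivAt_fderiv_fderiv (h : IsIsometryOn G G' φ U U') (hp : p ∈ U) :
    HasFDerivAt (fderiv ℝ (fderiv ℝ φ)) (fderiv ℝ (fderiv ℝ (fderiv ℝ φ)) p) p :=
  (((h.contDiffOn_fderiv.fderiv_of_isOpen h.metric.isOpen (m := ∞) (by simp)).contDiffAt
    (h.metric.isOpen.mem_nhds hp)).differentiableAt (by simp)).hasFDerivAt

lemma snd_fderiv_symm (h : IsIsometryOn G G' φ U U') (hp : p ∈ U) (u v : E) :
    fderiv ℝ (fderiv ℝ φ) p u v = fderiv ℝ (fderiv ℝ φ) p v u :=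
  (h.contDiffOn.contDiffAt (h.metric.isOpen.mem_nhds hp)).isSymmSndFDerivAt
    (by simpa using ENat.LEInfty.out) u v

lemma trd_fderiv_symm (h : IsIsometryOn G G' φ U U') (hp : p ∈ U) (u v w : E) :
    fderiv ℝ (fderiv ℝ (fderiv ℝ φ)) p u v w = fderiv ℝ (fderiv ℝ (fderiv ℝ φ)) p v u w := by
  rw [(h.contDiffOn_fderiv.contDiffAt (h.metric.isOpen.mem_nhds hp)).isSymmSndFDerivAt
    (by simpa using ENat.LEInfty.out) u v]

lemma fderiv_pullback (h : IsIsometryOn G G' φ U U') (hp : p ∈ U) (z u w : E) :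
    fderiv ℝ G p z u w
      = fderiv ℝ G' (φ p) (fderiv ℝ φ p z) (fderiv ℝ φ p u) (fderiv ℝ φ p w)
        + G' (φ p) (fderiv ℝ (fderiv ℝ φ) p z u) (fderiv ℝ φ p w)
        + G' (φ p) (fderiv ℝ φ p u) (fderiv ℝ (fderiv ℝ φ) p z w) := by
  have h1 : HasFDerivAt (fun q => G' (φ q)) _ p :=
    (h.metric'.differentiableAt (h.mapsTo hp)).hasFDerivAt.comp p (h.hasFDerivAt hp)
  have h2 : HasFDerivAt (fun q => G' (φ q) (fderiv ℝ φ q u) (fderiv ℝ φ q w)) _ p :=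
    (h1.clm_apply ((h.hasFDerivAt_fderiv hp).clm_apply (hasFDerivAt_const u p))).clm_apply
      ((h.hasFDerivAt_fderiv hp).clm_apply (hasFDerivAt_const w p))
  have h3 : (fun q => G q u w) =ᶠ[𝓝 p] fun q => G' (φ q) (fderiv ℝ φ q u) (fderiv ℝ φ q w) := by
    filter_upwards [h.metric.isOpen.mem_nhds hp] with q hq using h.pullback q hq u w
  rw [← h.metric.fderiv_apply_apply hp, h3.fderiv_eq, h2.fderiv]
  simp
  ring

/-- The transformation law of the Christoffel map. -/
lemma fderiv_christoffel (h : IsIsometryOn G G' φ U U') (hp : p ∈ U) (u w : E) :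
    fderiv ℝ φ p (christoffel G p u w)
      = christoffel G' (φ p) (fderiv ℝ φ p u) (fderiv ℝ φ p w) + fderiv ℝ (fderiv ℝ φ) p u w := by
  -- The target metric is nondegenerate and dφ is onto, so it is enough to pair with vectors dφ(z);
  -- both sides then become first derivatives of the metrics.
  refine eq_of_forall_apply_eq (h.metric'.isInvertible _ (h.mapsTo hp)) fun z' => ?_
  obtain ⟨z, rfl⟩ := h.surjective p hp z'
  rw [← h.pullback p hp, h.metric.apply_christoffel hp, map_add, add_apply,
    h.metric'.apply_christoffel (h.mapsTo hp), h.fderiv_pullback hp, h.fderiv_pullback hp,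
    h.fderiv_pullback hp, h.snd_fderiv_symm hp w u, h.snd_fderiv_symm hp z u,
    h.snd_fderiv_symm hp z w, h.metric'.symm _ (h.mapsTo hp) (fderiv ℝ φ p w),
    h.metric'.symm _ (h.mapsTo hp) (fderiv ℝ φ p u)]
  ring

/-- The derivative of the transformation law of Γ along `u`, which supplies the derivative terms of
the curvature. -/
lemma fderiv_fderiv_christoffel [CompleteSpace E] (h : IsIsometryOn G G' φ U U') (hp : p ∈ U)
    (u v w : E) :
    fderiv ℝ (fderiv ℝ φ) p u (christoffelCLM G p v w)
        + fderiv ℝ φ p (fderiv ℝ (christoffelCLM G) p u v w)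
      = fderiv ℝ (christoffelCLM G') (φ p) (fderiv ℝ φ p u) (fderiv ℝ φ p v) (fderiv ℝ φ p w)
        + christoffelCLM G' (φ p) (fderiv ℝ (fderiv ℝ φ) p u v) (fderiv ℝ φ p w)
        + christoffelCLM G' (φ p) (fderiv ℝ φ p v) (fderiv ℝ (fderiv ℝ φ) p u w)
        + fderiv ℝ (fderiv ℝ (fderiv ℝ φ)) p u v w := by
  have h1 : HasFDerivAt (fun q => christoffelCLM G' (φ q)) _ p :=
    (h.metric'.hasFDerivAt_christoffelCLM (h.mapsTo hp)).comp p (h.hasFDerivAt hp)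
  have hd := h.hasFDerivAt_fderiv hp
  have h2 : HasFDerivAt (fun q => christoffelCLM G' (φ q) (fderiv ℝ φ q v) (fderiv ℝ φ q w)
      + fderiv ℝ (fderiv ℝ φ) q v w) _ p :=
    ((h1.clm_apply (hd.clm_apply (hasFDerivAt_const v p))).clm_apply
      (hd.clm_apply (hasFDerivAt_const w p))).add
      (((h.hasFDerivAt_fderiv_fderiv hp).clm_apply (hasFDerivAt_const v p)).clm_apply
        (hasFDerivAt_const w p))
  have h3 : HasFDerivAt (fun q => fderiv ℝ φ q (christoffelCLM G q v w)) _ p :=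
    hd.clm_apply (((h.metric.hasFDerivAt_christoffelCLM hp).clm_apply
      (hasFDerivAt_const v p)).clm_apply (hasFDerivAt_const w p))
  have h4 : (fun q => fderiv ℝ φ q (christoffelCLM G q v w)) =ᶠ[𝓝 p]
      fun q => christoffelCLM G' (φ q) (fderiv ℝ φ q v) (fderiv ℝ φ q w)
      + fderiv ℝ (fderiv ℝ φ) q v w := by
    filter_upwards [h.metric.isOpen.mem_nhds hp] with q hq using h.fderiv_christoffel hq v w
  have h5 := congrArg (fun f => f u) (h3.unique (h2.congr_of_eventuallyEq h4))
  simp at h5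
  rw [add_comm, h5]
  abel

/-- The curvature is natural under local isometries. -/
lemma fderiv_curvature [CompleteSpace E] (h : IsIsometryOn G G' φ U U') (hp : p ∈ U) (u v w : E) :
    fderiv ℝ φ p (curvature G p u v w)
      = curvature G' (φ p) (fderiv ℝ φ p u) (fderiv ℝ φ p v) (fderiv ℝ φ p w) := by
  have hc : ∀ a b, fderiv ℝ φ p (christoffelCLM G p a b)
      = christoffelCLM G' (φ p) (fderiv ℝ φ p a) (fderiv ℝ φ p b)
        + fderiv ℝ (fderiv ℝ φ) p a b := h.fderiv_christoffel hp
  have h1 := h.fderiv_fderiv_christoffel hp u v w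
  have h2 := h.fderiv_fderiv_christoffel hp v u w
  rw [h.metric.curvature_eq hp, h.metric'.curvature_eq (h.mapsTo hp)]
  simp only [map_add, map_sub, hc]
  -- Antisymmetrising in u and v removes D³φ and the term Γ'(D²φ(u,v), ·); the other D²φ terms
  -- cancel against the quadratic terms in Γ.
  rw [h.trd_fderiv_symm hp v u, h.snd_fderiv_symm hp v u] at h2
  rw [← eq_sub_iff_add_eq'] at h1 h2
  rw [h1, h2]
  abel

/-- Differentiating the intertwining relation dφ ∘ A = A' ∘ dφ produces exactly the D²φ terms that
the transformation law of Γ introduces with the opposite sign. -/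
lemma fderiv_nablaEnd (h : IsIsometryOn G G' φ U U') (hp : p ∈ U) {A A' : E → E →L[ℝ] E}
    (hA : DifferentiableAt ℝ A p) (hA' : DifferentiableAt ℝ A' (φ p))
    (hAA' : ∀ q ∈ U, ∀ w, fderiv ℝ φ q (A q w) = A' (φ q) (fderiv ℝ φ q w)) (u w : E) :
    fderiv ℝ φ p (nablaEnd G A p u w)
      = nablaEnd G' A' (φ p) (fderiv ℝ φ p u) (fderiv ℝ φ p w) := by
  have hd := h.hasFDerivAt_fderiv hp
  have h1 : HasFDerivAt (fun q => A' (φ q)) _ p := hA'.hasFDerivAt.comp p (h.hasFDerivAt hp)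
  have h2 : HasFDerivAt (fun q => A' (φ q) (fderiv ℝ φ q w)) _ p :=
    h1.clm_apply (hd.clm_apply (hasFDerivAt_const w p))
  have h3 : HasFDerivAt (fun q => fderiv ℝ φ q (A q w)) _ p :=
    hd.clm_apply (hA.hasFDerivAt.clm_apply (hasFDerivAt_const w p))
  have h4 : (fun q => fderiv ℝ φ q (A q w)) =ᶠ[𝓝 p] fun q => A' (φ q) (fderiv ℝ φ q w) := by
    filter_upwards [h.metric.isOpen.mem_nhds hp] with q hq using hAA' q hq w
  have h5 := congrArg (fun f => f u) (h3.unique (h2.congr_of_eventuallyEq h4))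
  simp at h5
  simp only [nablaEnd, map_add, map_sub, h.fderiv_christoffel hp, hAA' p hp]
  rw [← eq_sub_iff_add_eq] at h5
  rw [h5]
  abel

end IsIsometryOn

end LocalGeometry

/-! ### Coordinate expressions of tensor fields and their smoothness -/

section Coordinates

variable {E : Type*} [NormedAddCommGroup E] [NormedSpace ℝ E]
  {M : Type*} [TopologicalSpace M] [ChartedSpace E M]

lemma chartBilin_apply
    (b : ∀ y : M, TangentSpace 𝓘(ℝ, E) y →L[ℝ] TangentSpace 𝓘(ℝ, E) y →L[ℝ] ℝ) (x : M) (p u w : E) :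
    chartBilin b x p u w = b ((extChartAt 𝓘(ℝ, E) x).symm p)
      ((chartDiff x ((extChartAt 𝓘(ℝ, E) x).symm p)).inverse u)
      ((chartDiff x ((extChartAt 𝓘(ℝ, E) x).symm p)).inverse w) := rfl

lemma chartEnd_apply
    (A : ∀ y : M, TangentSpace 𝓘(ℝ, E) y →L[ℝ] TangentSpace 𝓘(ℝ, E) y) (x : M) (p u : E) :
    chartEnd A x p u = chartDiff x ((extChartAt 𝓘(ℝ, E) x).symm p)
      (A ((extChartAt 𝓘(ℝ, E) x).symm p)
        ((chartDiff x ((extChartAt 𝓘(ℝ, E) x).symm p)).inverse u)) := rfl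

variable [IsManifold 𝓘(ℝ, E) ∞ M]

lemma chartDiff_isInvertible {x y : M} (hy : y ∈ (extChartAt 𝓘(ℝ, E) x).source) :
    (chartDiff (E := E) x y).IsInvertible :=
  isInvertible_mfderiv_extChartAt hy

lemma inverse_chartDiff_chartDiff {x y : M} (hy : y ∈ (extChartAt 𝓘(ℝ, E) x).source)
    (v : TangentSpace 𝓘(ℝ, E) y) : (chartDiff x y).inverse (chartDiff x y v) = v := by
  have h := (chartDiff_isInvertible hy).inverse_apply_eq (x := v) (y := chartDiff x y v)
  exact h.2 rfl

lemma chartDiff_inverse_chartDiff {x y : M} (hy : y ∈ (extChartAt 𝓘(ℝ, E) x).source)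
    (v : E) : chartDiff x y ((chartDiff x y).inverse v) = v := by
  have h := (chartDiff_isInvertible hy).inverse_apply_eq
    (x := (chartDiff x y).inverse v) (y := v)
  exact (h.1 rfl).symm

lemma chartDiff_injective {x y : M} (hy : y ∈ (extChartAt 𝓘(ℝ, E) x).source) :
    Function.Injective (chartDiff (E := E) x y) :=
  Function.LeftInverse.injective (inverse_chartDiff_chartDiff hy)

lemma chartBilin_extChartAt
    (b : ∀ y : M, TangentSpace 𝓘(ℝ, E) y →L[ℝ] TangentSpace 𝓘(ℝ, E) y →L[ℝ] ℝ) {x y : M}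
    (hy : y ∈ (extChartAt 𝓘(ℝ, E) x).source) (v w : TangentSpace 𝓘(ℝ, E) y) :
    chartBilin b x (extChartAt 𝓘(ℝ, E) x y) (chartDiff x y v) (chartDiff x y w) = b y v w := by
  rw [chartBilin_apply, (extChartAt 𝓘(ℝ, E) x).left_inv hy, inverse_chartDiff_chartDiff hy,
    inverse_chartDiff_chartDiff hy]

lemma chartEnd_extChartAt
    (A : ∀ y : M, TangentSpace 𝓘(ℝ, E) y →L[ℝ] TangentSpace 𝓘(ℝ, E) y) {x y : M}
    (hy : y ∈ (extChartAt 𝓘(ℝ, E) x).source) (v : TangentSpace 𝓘(ℝ, E) y) :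
    chartEnd A x (extChartAt 𝓘(ℝ, E) x y) (chartDiff x y v) = chartDiff x y (A y v) := by
  rw [chartEnd_apply, (extChartAt 𝓘(ℝ, E) x).left_inv hy, inverse_chartDiff_chartDiff hy]

/-- Translates smoothness in the tangent bundle, defined by trivializations, into smoothness of
coordinate components. -/
lemma trivializationAt_snd_eq_chartDiff {x y : M} (hy : y ∈ (extChartAt 𝓘(ℝ, E) x).source)
    (v : TangentSpace 𝓘(ℝ, E) y) :
    (trivializationAt E (TangentSpace 𝓘(ℝ, E)) x ⟨y, v⟩).2 = chartDiff x y v := by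
  rw [extChartAt_source] at hy
  have h := TangentBundle.continuousLinearMapAt_trivializationAt (I := 𝓘(ℝ, E)) hy
  rw [chartDiff, ← h, Trivialization.continuousLinearMapAt_apply_of_mem]
  simpa using hy

lemma contMDiffAt_inverse_chartDiff {x y : M} (hy : y ∈ (extChartAt 𝓘(ℝ, E) x).source) (u : E) :
    ContMDiffAt 𝓘(ℝ, E) (𝓘(ℝ, E).prod 𝓘(ℝ, E)) ∞
      (fun z : M => (⟨z, (chartDiff x z).inverse u⟩ : TangentBundle 𝓘(ℝ, E) M)) y := by
  have hb : y ∈ (trivializationAt E (TangentSpace 𝓘(ℝ, E)) x).baseSet := by simpa using hy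
  refine ((trivializationAt E (TangentSpace 𝓘(ℝ, E)) x).contMDiffAt_section_iff hb).2 ?_
  refine (contMDiffAt_const (c := u)).congr_of_eventuallyEq ?_
  filter_upwards [(isOpen_extChartAt_source (I := 𝓘(ℝ, E)) x).mem_nhds hy] with z hz
  rw [trivializationAt_snd_eq_chartDiff hz, chartDiff_inverse_chartDiff hz]

variable [FiniteDimensional ℝ E]

/-- In finite dimension it suffices to test on constant vectors, which correspond to coordinate
vector fields, smooth by `contMDiffAt_inverse_chartDiff`. -/
lemma contDiffOn_chartBilin
    {b : ∀ y : M, TangentSpace 𝓘(ℝ, E) y →L[ℝ] TangentSpace 𝓘(ℝ, E) y →L[ℝ] ℝ}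
    (hb : ContMDiff 𝓘(ℝ, E) (𝓘(ℝ, E).prod 𝓘(ℝ, E →L[ℝ] E →L[ℝ] ℝ)) ∞
      (fun x : M => TotalSpace.mk' (E →L[ℝ] E →L[ℝ] ℝ)
        (E := fun x : M => TangentSpace 𝓘(ℝ, E) x →L[ℝ] TangentSpace 𝓘(ℝ, E) x →L[ℝ] ℝ)
        x (b x))) (x : M) :
    ContDiffOn ℝ ∞ (chartBilin b x) (extChartAt 𝓘(ℝ, E) x).target := by
  refine contDiffOn_clm_apply.2 fun u => contDiffOn_clm_apply.2 fun w => ?_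
  have h1 : ContMDiffOn 𝓘(ℝ, E) 𝓘(ℝ, ℝ) ∞
      (fun y : M => b y ((chartDiff x y).inverse u) ((chartDiff x y).inverse w))
      (extChartAt 𝓘(ℝ, E) x).source := by
    intro y hy
    have h2 : ContMDiffAt 𝓘(ℝ, E) (𝓘(ℝ, E).prod 𝓘(ℝ, ℝ)) ∞
        (fun y : M => TotalSpace.mk' ℝ (E := Bundle.Trivial M ℝ) y
          (b y ((chartDiff x y).inverse u) ((chartDiff x y).inverse w))) y := by
      apply ContMDiffAt.clm_bundle_apply₂ (F₁ := E) (F₂ := E)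
      · exact hb y
      · exact contMDiffAt_inverse_chartDiff hy u
      · exact contMDiffAt_inverse_chartDiff hy w
    simp only [contMDiffAt_totalSpace] at h2
    exact h2.2.contMDiffWithinAt
  exact (h1.comp (contMDiffOn_extChartAt_symm x)
    (fun p hp => (extChartAt 𝓘(ℝ, E) x).map_target hp)).contDiffOn

end Coordinates

namespace MagneticSystem

variable {E : Type*} [NormedAddCommGroup E] [NormedSpace ℝ E] [FiniteDimensional ℝ E]
  {M : Type*} [TopologicalSpace M] [ChartedSpace E M] [IsManifold 𝓘(ℝ, E) ∞ M]
  (S : MagneticSystem E M)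

lemma lorentz_skew (x : M) (v w : TangentSpace 𝓘(ℝ, E) x) :
    S.metric.inner x (S.lorentz x v) w = -S.metric.inner x v (S.lorentz x w) := by
  have h := S.form_self x (v + w)
  simp only [map_add, add_apply, S.form_self] at h
  rw [S.metric.symm, ← S.form_eq_inner_lorentz, ← S.form_eq_inner_lorentz]
  linarith

lemma isMetricOn_chartBilin (x : M) :
    LocalGeometry.IsMetricOn (chartBilin S.metric.inner x) (extChartAt 𝓘(ℝ, E) x).target where
  isOpen := isOpen_extChartAt_target x
  contDiffOn := contDiffOn_chartBilin S.metric.contMDiff x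
  isInvertible p hp := by
    obtain ⟨e, he⟩ := chartDiff_isInvertible ((extChartAt 𝓘(ℝ, E) x).map_target hp)
    obtain ⟨g, hg⟩ := S.metric_isInvertible ((extChartAt 𝓘(ℝ, E) x).symm p)
    refine ⟨e.symm.trans (g.trans (e.symm.symm.arrowCongr (ContinuousLinearEquiv.refl ℝ ℝ))), ?_⟩
    ext u w
    rw [chartBilin_apply, ← he, ← hg, ContinuousLinearMap.inverse_equiv]
    rfl
  symm p _ u w := by rw [chartBilin_apply, chartBilin_apply, S.metric.symm]

/-- Smoothness of Ω is not part of the data; this formula derives it from that of the metric and the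
form. -/
lemma chartEnd_lorentz {x : M} {p : E} (hp : p ∈ (extChartAt 𝓘(ℝ, E) x).target) :
    chartEnd S.lorentz x p
      = -((chartBilin S.metric.inner x p).inverse.comp (chartBilin S.form x p)) := by
  obtain ⟨y, hy, rfl⟩ : ∃ y ∈ (extChartAt 𝓘(ℝ, E) x).source, extChartAt 𝓘(ℝ, E) x y = p :=
    ⟨_, (extChartAt 𝓘(ℝ, E) x).map_target hp, (extChartAt 𝓘(ℝ, E) x).right_inv hp⟩
  ext u
  have hG := (S.isMetricOn_chartBilin x).isInvertible _ hp
  refine LocalGeometry.eq_of_forall_apply_eq hG fun w => ?_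
  obtain ⟨v, rfl⟩ : ∃ v, chartDiff x y v = u := ⟨_, chartDiff_inverse_chartDiff hy u⟩
  obtain ⟨z, rfl⟩ : ∃ z, chartDiff x y z = w := ⟨_, chartDiff_inverse_chartDiff hy w⟩
  rw [chartEnd_extChartAt _ hy, chartBilin_extChartAt _ hy, S.lorentz_skew,
    ← S.form_eq_inner_lorentz]
  simp only [neg_apply, map_neg, ContinuousLinearMap.comp_apply,
    LocalGeometry.inverse_apply_self_left hG]
  rw [chartBilin_extChartAt _ hy]

lemma contDiffOn_chartEnd_lorentz (x : M) :
    ContDiffOn ℝ ∞ (chartEnd S.lorentz x) (extChartAt 𝓘(ℝ, E) x).target := by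
  have hG := S.isMetricOn_chartBilin x
  have hinv : ContDiffOn ℝ ∞ (fun q => (chartBilin S.metric.inner x q).inverse)
      (extChartAt 𝓘(ℝ, E) x).target := fun q hq =>
    (hG.isInvertible q hq).contDiffAt_map_inverse.comp_contDiffWithinAt q (hG.contDiffOn q hq)
  exact (hinv.clm_comp (contDiffOn_chartBilin S.form_smooth x)).neg.congr
    fun p hp => S.chartEnd_lorentz hp

lemma chartEnd_lorentz_skew (x : M) {p : E} (hp : p ∈ (extChartAt 𝓘(ℝ, E) x).target) (v w : E) :
    chartBilin S.metric.inner x p (chartEnd S.lorentz x p v) w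
      = -chartBilin S.metric.inner x p v (chartEnd S.lorentz x p w) := by
  have hy := (extChartAt 𝓘(ℝ, E) x).map_target hp
  simp only [chartBilin_apply, chartEnd_apply, inverse_chartDiff_chartDiff hy]
  exact S.lorentz_skew _ _ _

end MagneticSystem

/-! ### Chart transitions and independence of the chart -/

section Transition

variable {E : Type*} [NormedAddCommGroup E] [NormedSpace ℝ E]
  {M : Type*} [TopologicalSpace M] [ChartedSpace E M]

/-- The transition map from the preferred chart at `x` to the preferred chart at `x'`. -/
def chartTransition (x x' : M) (p : E) : E :=
  extChartAt 𝓘(ℝ, E) x' ((extChartAt 𝓘(ℝ, E) x).symm p)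

/-- The domain of the transition map between two preferred charts. -/
def chartOverlap (x x' : M) : Set E :=
  (extChartAt 𝓘(ℝ, E) x).target
    ∩ (extChartAt 𝓘(ℝ, E) x).symm ⁻¹' (extChartAt 𝓘(ℝ, E) x').source

lemma isOpen_chartOverlap (x x' : M) : IsOpen (chartOverlap (E := E) x x') :=
  (continuousOn_extChartAt_symm x).isOpen_inter_preimage (isOpen_extChartAt_target x)
    (isOpen_extChartAt_source x')

variable {x x' y : M}

lemma extChartAt_mem_chartOverlap (hy : y ∈ (extChartAt 𝓘(ℝ, E) x).source)
    (hy' : y ∈ (extChartAt 𝓘(ℝ, E) x').source) : extChartAt 𝓘(ℝ, E) x y ∈ chartOverlap x x' :=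
  ⟨(extChartAt 𝓘(ℝ, E) x).map_source hy, by
    rwa [mem_preimage, (extChartAt 𝓘(ℝ, E) x).left_inv hy]⟩

lemma chartTransition_extChartAt (hy : y ∈ (extChartAt 𝓘(ℝ, E) x).source) :
    chartTransition x x' (extChartAt 𝓘(ℝ, E) x y) = extChartAt 𝓘(ℝ, E) x' y := by
  rw [chartTransition, (extChartAt 𝓘(ℝ, E) x).left_inv hy]

variable [IsManifold 𝓘(ℝ, E) ∞ M]

lemma contDiffOn_chartTransition (x x' : M) :
    ContDiffOn ℝ ∞ (chartTransition (E := E) x x') (chartOverlap x x') := by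
  refine ContMDiffOn.contDiffOn ?_
  have h1 : ContMDiffOn 𝓘(ℝ, E) 𝓘(ℝ, E) ∞ (extChartAt 𝓘(ℝ, E) x')
      (extChartAt 𝓘(ℝ, E) x').source := by
    rw [extChartAt_source]; exact contMDiffOn_extChartAt
  exact h1.comp ((contMDiffOn_extChartAt_symm x).mono inter_subset_left) inter_subset_right

lemma fderiv_chartTransition (hy : y ∈ (extChartAt 𝓘(ℝ, E) x).source)
    (hy' : y ∈ (extChartAt 𝓘(ℝ, E) x').source) (v : TangentSpace 𝓘(ℝ, E) y) :
    fderiv ℝ (chartTransition x x') (extChartAt 𝓘(ℝ, E) x y) (chartDiff x y v)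
      = chartDiff x' y v := by
  have hφ : MDifferentiableAt 𝓘(ℝ, E) 𝓘(ℝ, E) (chartTransition x x')
      (extChartAt 𝓘(ℝ, E) x y) :=
    (((contDiffOn_chartTransition x x').contDiffAt ((isOpen_chartOverlap x x').mem_nhds
      (extChartAt_mem_chartOverlap hy hy'))).differentiableAt (by simp)).mdifferentiableAt
  have hx : MDifferentiableAt 𝓘(ℝ, E) 𝓘(ℝ, E) (extChartAt 𝓘(ℝ, E) x) y :=
    mdifferentiableAt_extChartAt (by simpa using hy)
  have h1 := mfderiv_comp y hφ hx
  have h2 : chartTransition x x' ∘ extChartAt 𝓘(ℝ, E) x =ᶠ[𝓝 y] extChartAt 𝓘(ℝ, E) x' := by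
    filter_upwards [(isOpen_extChartAt_source x).mem_nhds hy] with z hz
      using chartTransition_extChartAt hz
  rw [h2.mfderiv_eq, mfderiv_eq_fderiv] at h1
  exact (congrArg (fun f => f v) h1).symm

end Transition

lemma LocalGeometry.IsMetricOn.mono {E : Type*} [NormedAddCommGroup E] [NormedSpace ℝ E]
    {G : E → E →L[ℝ] E →L[ℝ] ℝ} {U V : Set E} (h : LocalGeometry.IsMetricOn G U)
    (hV : IsOpen V) (hVU : V ⊆ U) : LocalGeometry.IsMetricOn G V where
  isOpen := hV
  contDiffOn := h.contDiffOn.mono hVU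
  isInvertible p hp := h.isInvertible p (hVU hp)
  symm p hp := h.symm p (hVU hp)

section Transition

variable {E : Type*} [NormedAddCommGroup E] [NormedSpace ℝ E]
  {M : Type*} [TopologicalSpace M] [ChartedSpace E M] [IsManifold 𝓘(ℝ, E) ∞ M]

lemma fderiv_chartTransition_injective {x x' y : M} (hy : y ∈ (extChartAt 𝓘(ℝ, E) x).source)
    (hy' : y ∈ (extChartAt 𝓘(ℝ, E) x').source) :
    Function.Injective (fderiv ℝ (chartTransition x x') (extChartAt 𝓘(ℝ, E) x y)) := by
  intro u w h
  obtain ⟨v, rfl⟩ : ∃ v, chartDiff x y v = u := ⟨_, chartDiff_inverse_chartDiff hy u⟩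
  obtain ⟨z, rfl⟩ : ∃ z, chartDiff x y z = w := ⟨_, chartDiff_inverse_chartDiff hy w⟩
  rw [fderiv_chartTransition hy hy', fderiv_chartTransition hy hy'] at h
  rw [chartDiff_injective hy' h]

end Transition

namespace MagneticSystem

variable {E : Type*} [NormedAddCommGroup E] [NormedSpace ℝ E] [FiniteDimensional ℝ E]
  {M : Type*} [TopologicalSpace M] [ChartedSpace E M] [IsManifold 𝓘(ℝ, E) ∞ M]
  (S : MagneticSystem E M)

/-- Both coordinate metrics express the same metric on M, and the differential of the transition map
carries one set of components of a vector to the other. -/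
lemma isIsometryOn_chartTransition (x x' : M) :
    LocalGeometry.IsIsometryOn (chartBilin S.metric.inner x) (chartBilin S.metric.inner x')
      (chartTransition x x') (chartOverlap x x') (extChartAt 𝓘(ℝ, E) x').target where
  metric := (S.isMetricOn_chartBilin x).mono (isOpen_chartOverlap x x') inter_subset_left
  metric' := S.isMetricOn_chartBilin x'
  contDiffOn := contDiffOn_chartTransition x x'
  mapsTo p hp := (extChartAt 𝓘(ℝ, E) x').map_source hp.2
  surjective := by
    rintro p ⟨hp, hp'⟩ u
    have hy := (extChartAt 𝓘(ℝ, E) x).map_target hp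
    refine ⟨chartDiff x _ ((chartDiff x' ((extChartAt 𝓘(ℝ, E) x).symm p)).inverse u), ?_⟩
    have h := fderiv_chartTransition hy hp'
      ((chartDiff x' ((extChartAt 𝓘(ℝ, E) x).symm p)).inverse u)
    rwa [(extChartAt 𝓘(ℝ, E) x).right_inv hp, chartDiff_inverse_chartDiff hp'] at h
  pullback := by
    rintro p ⟨hp, hp'⟩ u w
    obtain ⟨y, hy, rfl⟩ : ∃ y ∈ (extChartAt 𝓘(ℝ, E) x).source, extChartAt 𝓘(ℝ, E) x y = p :=
      ⟨_, (extChartAt 𝓘(ℝ, E) x).map_target hp, (extChartAt 𝓘(ℝ, E) x).right_inv hp⟩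
    rw [mem_preimage, (extChartAt 𝓘(ℝ, E) x).left_inv hy] at hp'
    obtain ⟨v, rfl⟩ : ∃ v, chartDiff x y v = u := ⟨_, chartDiff_inverse_chartDiff hy u⟩
    obtain ⟨z, rfl⟩ : ∃ z, chartDiff x y z = w := ⟨_, chartDiff_inverse_chartDiff hy w⟩
    rw [fderiv_chartTransition hy hp', fderiv_chartTransition hy hp', chartTransition_extChartAt hy,
      chartBilin_extChartAt _ hy, chartBilin_extChartAt _ hp']

/-- By definition the identity holds in the chart centred at `y`; naturality under the transition
map carries it to any chart containing `y`. -/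
lemma chartDiff_curvature {x y : M} (hy : y ∈ (extChartAt 𝓘(ℝ, E) x).source)
    (u v w : TangentSpace 𝓘(ℝ, E) y) :
    chartDiff x y (S.curvature y u v w)
      = LocalGeometry.curvature (chartBilin S.metric.inner x) (extChartAt 𝓘(ℝ, E) x y)
        (chartDiff x y u) (chartDiff x y v) (chartDiff x y w) := by
  have hy' := mem_extChartAt_source (I := 𝓘(ℝ, E)) y
  apply fderiv_chartTransition_injective hy hy'
  rw [(S.isIsometryOn_chartTransition x y).fderiv_curvature (extChartAt_mem_chartOverlap hy hy'),
    chartTransition_extChartAt hy]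
  simp only [fderiv_chartTransition hy hy']
  rw [curvature, chartDiff_inverse_chartDiff hy']

lemma chartDiff_nablaLorentz {x y : M} (hy : y ∈ (extChartAt 𝓘(ℝ, E) x).source)
    (u w : TangentSpace 𝓘(ℝ, E) y) :
    chartDiff x y (S.nablaLorentz y u w)
      = LocalGeometry.nablaEnd (chartBilin S.metric.inner x) (chartEnd S.lorentz x)
        (extChartAt 𝓘(ℝ, E) x y) (chartDiff x y u) (chartDiff x y w) := by
  have hy' := mem_extChartAt_source (I := 𝓘(ℝ, E)) y
  have hA : ∀ x, ∀ q ∈ (extChartAt 𝓘(ℝ, E) x).target,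
      DifferentiableAt ℝ (chartEnd S.lorentz x) q := fun x q hq =>
    ((S.contDiffOn_chartEnd_lorentz x).contDiffAt
      ((isOpen_extChartAt_target x).mem_nhds hq)).differentiableAt (by simp)
  apply fderiv_chartTransition_injective hy hy'
  rw [(S.isIsometryOn_chartTransition x y).fderiv_nablaEnd (extChartAt_mem_chartOverlap hy hy')
      (hA x _ ((extChartAt 𝓘(ℝ, E) x).map_source hy)) (A' := chartEnd S.lorentz y) ?_ ?_,
    chartTransition_extChartAt hy]
  · simp only [fderiv_chartTransition hy hy']
    rw [nablaLorentz, chartDiff_inverse_chartDiff hy']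
  · rw [chartTransition_extChartAt hy]
    exact hA y _ ((extChartAt 𝓘(ℝ, E) y).map_source hy')
  · rintro q ⟨hq, hq'⟩ u
    obtain ⟨z, hz, rfl⟩ : ∃ z ∈ (extChartAt 𝓘(ℝ, E) x).source, extChartAt 𝓘(ℝ, E) x z = q :=
      ⟨_, (extChartAt 𝓘(ℝ, E) x).map_target hq, (extChartAt 𝓘(ℝ, E) x).right_inv hq⟩
    rw [mem_preimage, (extChartAt 𝓘(ℝ, E) x).left_inv hz] at hq'
    obtain ⟨v, rfl⟩ : ∃ v, chartDiff x z v = u := ⟨_, chartDiff_inverse_chartDiff hz u⟩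
    rw [chartEnd_extChartAt _ hz, fderiv_chartTransition hz hq', fderiv_chartTransition hz hq',
      chartTransition_extChartAt hz, chartEnd_extChartAt _ hq']

/-- The second derivative of the transition map enters twice, from differentiating the components of
V and from the inhomogeneous term in the law for Γ, and the two contributions cancel. -/
lemma chartDiff_covDeriv {γ : ℝ → M} {V : ∀ t : ℝ, TangentSpace 𝓘(ℝ, E) (γ t)} {x : M} {t : ℝ}
    (ht : γ t ∈ (extChartAt 𝓘(ℝ, E) x).source) (hγ : ContinuousAt γ t)
    (hc : DifferentiableAt ℝ (fun r => extChartAt 𝓘(ℝ, E) x (γ r)) t)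
    (hV : DifferentiableAt ℝ (fun r => chartDiff x (γ r) (V r)) t) :
    chartDiff x (γ t) (S.covDeriv γ V t)
      = deriv (fun r => chartDiff x (γ r) (V r)) t
        + LocalGeometry.christoffel (chartBilin S.metric.inner x) (extChartAt 𝓘(ℝ, E) x (γ t))
          (deriv (fun r => extChartAt 𝓘(ℝ, E) x (γ r)) t) (chartDiff x (γ t) (V t)) := by
  have ht' := mem_extChartAt_source (I := 𝓘(ℝ, E)) (γ t)
  have hiso := S.isIsometryOn_chartTransition x (γ t)
  have hp := extChartAt_mem_chartOverlap ht ht'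
  have hev : ∀ᶠ r in 𝓝 t, γ r ∈ (extChartAt 𝓘(ℝ, E) x).source :=
    hγ.eventually_mem ((isOpen_extChartAt_source x).mem_nhds ht)
  have hev' : ∀ᶠ r in 𝓝 t, γ r ∈ (extChartAt 𝓘(ℝ, E) (γ t)).source :=
    hγ.eventually_mem ((isOpen_extChartAt_source (γ t)).mem_nhds ht')
  have h1 : deriv (fun r => extChartAt 𝓘(ℝ, E) (γ t) (γ r)) t
      = fderiv ℝ (chartTransition x (γ t)) (extChartAt 𝓘(ℝ, E) x (γ t))
        (deriv (fun r => extChartAt 𝓘(ℝ, E) x (γ r)) t) := by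
    have h : HasDerivAt (fun r => chartTransition x (γ t) (extChartAt 𝓘(ℝ, E) x (γ r))) _ t :=
      HasFDerivAt.comp_hasDerivAt (l := chartTransition x (γ t))
        (f := fun r => extChartAt 𝓘(ℝ, E) x (γ r)) t (hiso.hasFDerivAt hp) hc.hasDerivAt
    rw [← h.deriv]
    apply Filter.EventuallyEq.deriv_eq
    filter_upwards [hev] with r hr using (chartTransition_extChartAt hr).symm
  have h2 : deriv (fun r => chartDiff (γ t) (γ r) (V r)) t
      = fderiv ℝ (fderiv ℝ (chartTransition x (γ t))) (extChartAt 𝓘(ℝ, E) x (γ t))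
          (deriv (fun r => extChartAt 𝓘(ℝ, E) x (γ r)) t) (chartDiff x (γ t) (V t))
        + fderiv ℝ (chartTransition x (γ t)) (extChartAt 𝓘(ℝ, E) x (γ t))
          (deriv (fun r => chartDiff x (γ r) (V r)) t) := by
    have h' : HasDerivAt (fun r => fderiv ℝ (chartTransition x (γ t))
        (extChartAt 𝓘(ℝ, E) x (γ r))) _ t :=
      (hiso.hasFDerivAt_fderiv hp).comp_hasDerivAt t hc.hasDerivAt
    have h := h'.clm_apply hV.hasDerivAt
    rw [← h.deriv]
    apply Filter.EventuallyEq.deriv_eq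
    filter_upwards [hev, hev'] with r hr hr' using (fderiv_chartTransition hr hr' (V r)).symm
  apply fderiv_chartTransition_injective ht ht'
  rw [fderiv_chartTransition ht ht', covDeriv, chartDiff_inverse_chartDiff ht', h1, h2, map_add,
    hiso.fderiv_christoffel hp, chartTransition_extChartAt ht, fderiv_chartTransition ht ht']
  abel

end MagneticSystem

/-! ### Smooth vector fields along a curve and Leibniz rules -/

section Along

variable {E : Type*} [NormedAddCommGroup E] [NormedSpace ℝ E]
  {M : Type*} [TopologicalSpace M] [ChartedSpace E M]

/-- `V`, restricted to the open set `I`, is a smooth vector field along the curve `γ`, expressed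
in terms of all preferred charts. -/
structure IsSmoothAlong (γ : ℝ → M) (I : Set ℝ) (V : ∀ t : ℝ, TangentSpace 𝓘(ℝ, E) (γ t)) :
    Prop where
  contDiffOn (x : M) : ContDiffOn ℝ ∞ (fun r => chartDiff x (γ r) (V r))
    (I ∩ γ ⁻¹' (extChartAt 𝓘(ℝ, E) x).source)

variable {γ : ℝ → M} {I : Set ℝ}

lemma isOpen_curve_preimage (hI : IsOpen I) (hγ : ContinuousOn γ I) (x : M) :
    IsOpen (I ∩ γ ⁻¹' (extChartAt 𝓘(ℝ, E) x).source) :=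
  hγ.isOpen_inter_preimage hI (isOpen_extChartAt_source x)

lemma IsSmoothAlong.differentiableAt {V : ∀ t : ℝ, TangentSpace 𝓘(ℝ, E) (γ t)}
    (hV : IsSmoothAlong γ I V) (hI : IsOpen I)
    (hγ : ContinuousOn γ I) {x : M} {t : ℝ} (ht : t ∈ I)
    (hx : γ t ∈ (extChartAt 𝓘(ℝ, E) x).source) :
    DifferentiableAt ℝ (fun r => chartDiff x (γ r) (V r)) t :=
  ((hV.contDiffOn x).contDiffAt
    ((isOpen_curve_preimage hI hγ x).mem_nhds ⟨ht, hx⟩)).differentiableAt (by simp)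

variable [IsManifold 𝓘(ℝ, E) ∞ M]

lemma contDiffOn_extChartAt_curve (hγ : ContMDiffOn 𝓘(ℝ, ℝ) 𝓘(ℝ, E) ∞ γ I) (x : M) :
    ContDiffOn ℝ ∞ (fun r => extChartAt 𝓘(ℝ, E) x (γ r))
      (I ∩ γ ⁻¹' (extChartAt 𝓘(ℝ, E) x).source) := by
  have h1 : ContMDiffOn 𝓘(ℝ, E) 𝓘(ℝ, E) ∞ (extChartAt 𝓘(ℝ, E) x)
      (extChartAt 𝓘(ℝ, E) x).source := by
    rw [extChartAt_source]; exact contMDiffOn_extChartAt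
  exact (h1.comp (hγ.mono inter_subset_left) inter_subset_right).contDiffOn

lemma differentiableAt_extChartAt_curve (hI : IsOpen I)
    (hγ : ContMDiffOn 𝓘(ℝ, ℝ) 𝓘(ℝ, E) ∞ γ I) {x : M} {t : ℝ} (ht : t ∈ I)
    (hx : γ t ∈ (extChartAt 𝓘(ℝ, E) x).source) :
    DifferentiableAt ℝ (fun r => extChartAt 𝓘(ℝ, E) x (γ r)) t :=
  ((contDiffOn_extChartAt_curve hγ x).contDiffAt
    ((isOpen_curve_preimage hI hγ.continuousOn x).mem_nhds ⟨ht, hx⟩)).differentiableAt (by simp)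

lemma IsSmoothAlong.of_contMDiffOn {V : ∀ t : ℝ, TangentSpace 𝓘(ℝ, E) (γ t)}
    (hV : ContMDiffOn 𝓘(ℝ, ℝ) (𝓘(ℝ, E).prod 𝓘(ℝ, E)) ∞
      (fun t => (⟨γ t, V t⟩ : TangentBundle 𝓘(ℝ, E) M)) I) : IsSmoothAlong γ I V where
  contDiffOn x := by
    have h1 : MapsTo (fun t => (⟨γ t, V t⟩ : TangentBundle 𝓘(ℝ, E) M))
        (I ∩ γ ⁻¹' (extChartAt 𝓘(ℝ, E) x).source)
        (trivializationAt E (TangentSpace 𝓘(ℝ, E)) x).source := by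
      intro t ht
      rw [Trivialization.mem_source]
      simpa using ht.2
    have h2 := ((Trivialization.contMDiffOn_iff h1).1 (hV.mono inter_subset_left)).2
    refine h2.contDiffOn.congr fun t ht => ?_
    exact (trivializationAt_snd_eq_chartDiff ht.2 (V t)).symm

lemma chartDiff_velocity (hI : IsOpen I) (hγ : ContMDiffOn 𝓘(ℝ, ℝ) 𝓘(ℝ, E) ∞ γ I) {x : M} {t : ℝ}
    (ht : t ∈ I) (hx : γ t ∈ (extChartAt 𝓘(ℝ, E) x).source) :
    chartDiff x (γ t) (velocity γ t) = deriv (fun r => extChartAt 𝓘(ℝ, E) x (γ r)) t := by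
  have h1 : MDifferentiableAt 𝓘(ℝ, ℝ) 𝓘(ℝ, E) γ t :=
    ((hγ t ht).contMDiffAt (hI.mem_nhds ht)).mdifferentiableAt (by simp)
  have h2 : MDifferentiableAt 𝓘(ℝ, E) 𝓘(ℝ, E) (extChartAt 𝓘(ℝ, E) x) (γ t) :=
    mdifferentiableAt_extChartAt (by simpa using hx)
  have h3 := mfderiv_comp t h2 h1
  rw [mfderiv_eq_fderiv] at h3
  exact (congrArg (fun f => f (1 : ℝ)) h3).symm

lemma IsSmoothAlong.velocity (hI : IsOpen I) (hγ : ContMDiffOn 𝓘(ℝ, ℝ) 𝓘(ℝ, E) ∞ γ I) :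
    IsSmoothAlong (E := E) γ I (velocity γ) where
  contDiffOn x := ((contDiffOn_extChartAt_curve hγ x).deriv_of_isOpen
    (isOpen_curve_preimage hI hγ.continuousOn x) (by simp)).congr
    fun _ ht => chartDiff_velocity hI hγ ht.1 ht.2

end Along

namespace MagneticSystem

variable {E : Type*} [NormedAddCommGroup E] [NormedSpace ℝ E] [FiniteDimensional ℝ E]
  {M : Type*} [TopologicalSpace M] [ChartedSpace E M] [IsManifold 𝓘(ℝ, E) ∞ M]
  (S : MagneticSystem E M) {γ : ℝ → M} {I : Set ℝ}
  {V W : ∀ t : ℝ, TangentSpace 𝓘(ℝ, E) (γ t)}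

lemma chartDiff_covDeriv_of_isSmoothAlong (hI : IsOpen I)
    (hγ : ContMDiffOn 𝓘(ℝ, ℝ) 𝓘(ℝ, E) ∞ γ I) (hV : IsSmoothAlong γ I V) {x : M} {t : ℝ} (ht : t ∈ I)
    (hx : γ t ∈ (extChartAt 𝓘(ℝ, E) x).source) :
    chartDiff x (γ t) (S.covDeriv γ V t)
      = deriv (fun r => chartDiff x (γ r) (V r)) t
        + LocalGeometry.christoffel (chartBilin S.metric.inner x) (extChartAt 𝓘(ℝ, E) x (γ t))
          (deriv (fun r => extChartAt 𝓘(ℝ, E) x (γ r)) t) (chartDiff x (γ t) (V t)) :=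
  S.chartDiff_covDeriv hx (hγ.continuousOn.continuousAt (hI.mem_nhds ht))
    (differentiableAt_extChartAt_curve hI hγ ht hx) (hV.differentiableAt hI hγ.continuousOn ht hx)

lemma isSmoothAlong_covDeriv (hI : IsOpen I) (hγ : ContMDiffOn 𝓘(ℝ, ℝ) 𝓘(ℝ, E) ∞ γ I)
    (hV : IsSmoothAlong γ I V) : IsSmoothAlong γ I (S.covDeriv γ V) where
  contDiffOn x := by
    have hN := isOpen_curve_preimage (E := E) hI hγ.continuousOn x
    have hΓ := (S.isMetricOn_chartBilin x).contDiffOn_christoffelCLM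
    have hc := contDiffOn_extChartAt_curve hγ x
    have h1 := hΓ.comp hc fun t ht => (extChartAt 𝓘(ℝ, E) x).map_source ht.2
    refine (((hV.contDiffOn x).deriv_of_isOpen hN (by simp)).add
      ((h1.clm_apply (hc.deriv_of_isOpen hN (by simp))).clm_apply (hV.contDiffOn x))).congr
      fun t ht => ?_
    exact S.chartDiff_covDeriv_of_isSmoothAlong hI hγ hV ht.1 ht.2

lemma isSmoothAlong_lorentz (hγ : ContMDiffOn 𝓘(ℝ, ℝ) 𝓘(ℝ, E) ∞ γ I)
    (hV : IsSmoothAlong γ I V) : IsSmoothAlong γ I (fun t => S.lorentz (γ t) (V t)) where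
  contDiffOn x := by
    have h1 := (S.contDiffOn_chartEnd_lorentz x).comp (contDiffOn_extChartAt_curve hγ x)
      fun t ht => (extChartAt 𝓘(ℝ, E) x).map_source ht.2
    exact (h1.clm_apply (hV.contDiffOn x)).congr
      fun t ht => (chartEnd_extChartAt S.lorentz ht.2 (V t)).symm

/-- The product rule in the chart centred at γ t, where metric compatibility turns the derivative of
the metric into the two Christoffel terms. -/
lemma hasDerivAt_inner (hI : IsOpen I) (hγ : ContMDiffOn 𝓘(ℝ, ℝ) 𝓘(ℝ, E) ∞ γ I)
    (hV : IsSmoothAlong γ I V) (hW : IsSmoothAlong γ I W) {t : ℝ} (ht : t ∈ I) :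
    HasDerivAt (fun r => S.metric.inner (γ r) (V r) (W r))
      (S.metric.inner (γ t) (S.covDeriv γ V t) (W t)
        + S.metric.inner (γ t) (V t) (S.covDeriv γ W t)) t := by
  have hx := mem_extChartAt_source (I := 𝓘(ℝ, E)) (γ t)
  have hG := S.isMetricOn_chartBilin (γ t)
  have hp := (extChartAt 𝓘(ℝ, E) (γ t)).map_source hx
  have h1 : HasDerivAt (fun r => chartBilin S.metric.inner (γ t)
      (extChartAt 𝓘(ℝ, E) (γ t) (γ r))) _ t :=
    HasFDerivAt.comp_hasDerivAt (l := chartBilin S.metric.inner (γ t))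
      (f := fun r => extChartAt 𝓘(ℝ, E) (γ t) (γ r)) t (hG.differentiableAt hp).hasFDerivAt
      (differentiableAt_extChartAt_curve hI hγ ht hx).hasDerivAt
  have h2 := (h1.clm_apply (hV.differentiableAt hI hγ.continuousOn ht hx).hasDerivAt).clm_apply
    (hW.differentiableAt hI hγ.continuousOn ht hx).hasDerivAt
  refine (h2.congr_of_eventuallyEq ?_).congr_deriv ?_
  · filter_upwards [(isOpen_curve_preimage hI hγ.continuousOn (γ t)).mem_nhds ⟨ht, hx⟩] with r hr
      using (chartBilin_extChartAt S.metric.inner hr.2 (V r) (W r)).symm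
  · rw [← chartBilin_extChartAt S.metric.inner hx, ← chartBilin_extChartAt S.metric.inner hx,
      S.chartDiff_covDeriv_of_isSmoothAlong hI hγ hV ht hx,
      S.chartDiff_covDeriv_of_isSmoothAlong hI hγ hW ht hx]
    simp only [map_add, add_apply, hG.compatible hp]
    ring

lemma covDeriv_lorentz (hI : IsOpen I) (hγ : ContMDiffOn 𝓘(ℝ, ℝ) 𝓘(ℝ, E) ∞ γ I)
    (hV : IsSmoothAlong γ I V) {t : ℝ} (ht : t ∈ I) :
    S.covDeriv γ (fun t => S.lorentz (γ t) (V t)) t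
      = S.nablaLorentz (γ t) (velocity γ t) (V t) + S.lorentz (γ t) (S.covDeriv γ V t) := by
  have hx := mem_extChartAt_source (I := 𝓘(ℝ, E)) (γ t)
  have hp := (extChartAt 𝓘(ℝ, E) (γ t)).map_source hx
  have hA : DifferentiableAt ℝ (chartEnd S.lorentz (γ t)) (extChartAt 𝓘(ℝ, E) (γ t) (γ t)) :=
    ((S.contDiffOn_chartEnd_lorentz (γ t)).contDiffAt
      ((isOpen_extChartAt_target (γ t)).mem_nhds hp)).differentiableAt (by simp)
  have h1 : HasDerivAt (fun r => chartEnd S.lorentz (γ t)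
      (extChartAt 𝓘(ℝ, E) (γ t) (γ r))) _ t :=
    HasFDerivAt.comp_hasDerivAt (l := chartEnd S.lorentz (γ t))
      (f := fun r => extChartAt 𝓘(ℝ, E) (γ t) (γ r)) t hA.hasFDerivAt
      (differentiableAt_extChartAt_curve hI hγ ht hx).hasDerivAt
  have h2 := h1.clm_apply (hV.differentiableAt hI hγ.continuousOn ht hx).hasDerivAt
  have h3 : (fun r => chartDiff (γ t) (γ r) (S.lorentz (γ r) (V r))) =ᶠ[𝓝 t] fun r =>
      chartEnd S.lorentz (γ t) (extChartAt 𝓘(ℝ, E) (γ t) (γ r)) (chartDiff (γ t) (γ r) (V r)) := by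
    filter_upwards [(isOpen_curve_preimage hI hγ.continuousOn (γ t)).mem_nhds ⟨ht, hx⟩] with r hr
      using (chartEnd_extChartAt S.lorentz hr.2 (V r)).symm
  apply chartDiff_injective hx
  rw [S.chartDiff_covDeriv_of_isSmoothAlong hI hγ (S.isSmoothAlong_lorentz hγ hV) ht hx,
    h3.deriv_eq, h2.deriv, map_add, S.chartDiff_nablaLorentz hx, ← chartEnd_extChartAt S.lorentz hx,
    ← chartEnd_extChartAt S.lorentz hx, S.chartDiff_covDeriv_of_isSmoothAlong hI hγ hV ht hx,
    chartDiff_velocity hI hγ ht hx, LocalGeometry.nablaEnd, map_add]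
  abel

end MagneticSystem

/-! ### Pointwise algebra and the second variation inequality -/

namespace LocalGeometry

variable {E : Type*} [NormedAddCommGroup E] [NormedSpace ℝ E]
  {G : E → E →L[ℝ] E →L[ℝ] ℝ} {U : Set E} {p : E}

lemma curvature_self (G : E → E →L[ℝ] E →L[ℝ] ℝ) (p v w : E) : curvature G p v v w = 0 := by
  simp [curvature]

lemma IsMetricOn.curvature_add_left [CompleteSpace E] (h : IsMetricOn G U) (hp : p ∈ U)
    (u u' v w : E) :
    curvature G p (u + u') v w = curvature G p u v w + curvature G p u' v w := by
  simp only [h.curvature_eq hp, map_add, add_apply]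
  abel

lemma IsMetricOn.curvature_smul [CompleteSpace E] (h : IsMetricOn G U) (hp : p ∈ U)
    (a b c : ℝ) (u v w : E) :
    curvature G p (a • u) (b • v) (c • w) = (a * b * c) • curvature G p u v w := by
  simp only [h.curvature_eq hp, map_smul, smul_apply]
  module

end LocalGeometry

namespace MagneticSystem

section Positivity

variable {E : Type*} [NormedAddCommGroup E] [NormedSpace ℝ E]
  {M : Type*} [TopologicalSpace M] [ChartedSpace E M] [IsManifold 𝓘(ℝ, E) ∞ M]
  (S : MagneticSystem E M) (x : M)

lemma inner_self_nonneg (v : TangentSpace 𝓘(ℝ, E) x) : 0 ≤ S.metric.inner x v v := by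
  by_cases hv : v = 0
  · simp [hv]
  · exact (S.metric.pos x v hv).le

lemma eq_zero_of_inner_self {v : TangentSpace 𝓘(ℝ, E) x} (h : S.metric.inner x v v = 0) :
    v = 0 := by
  by_contra hv
  exact (S.metric.pos x v hv).ne' h

lemma inner_sq_le (v w : TangentSpace 𝓘(ℝ, E) x) :
    S.metric.inner x v w ^ 2 ≤ S.metric.inner x v v * S.metric.inner x w w := by
  by_cases hw : w = 0
  · simp [hw]
  have hpos := S.metric.pos x w hw
  have h := S.inner_self_nonneg x
    (S.metric.inner x w w • v - S.metric.inner x v w • w)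
  simp only [map_sub, map_smul, sub_apply, smul_apply, smul_eq_mul, S.metric.symm x w v] at h
  -- The nonnegative square of ⟨w,w⟩v − ⟨v,w⟩w is ⟨w,w⟩ times the Cauchy–Schwarz defect.
  refine le_of_mul_le_mul_left ?_ hpos
  nlinarith [h]

end Positivity

variable {E : Type*} [NormedAddCommGroup E] [NormedSpace ℝ E] [FiniteDimensional ℝ E]
  {M : Type*} [TopologicalSpace M] [ChartedSpace E M] [IsManifold 𝓘(ℝ, E) ∞ M]
  (S : MagneticSystem E M) (x : M)

lemma curvature_self_left (v w : TangentSpace 𝓘(ℝ, E) x) : S.curvature x v v w = 0 := by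
  apply chartDiff_injective (mem_extChartAt_source (I := 𝓘(ℝ, E)) x)
  rw [S.chartDiff_curvature (mem_extChartAt_source x), LocalGeometry.curvature_self, map_zero]

lemma curvature_add_left (u u' v w : TangentSpace 𝓘(ℝ, E) x) :
    S.curvature x (u + u') v w = S.curvature x u v w + S.curvature x u' v w := by
  have hx := mem_extChartAt_source (I := 𝓘(ℝ, E)) x
  apply chartDiff_injective hx
  rw [map_add]
  simp only [S.chartDiff_curvature hx]
  rw [map_add, (S.isMetricOn_chartBilin x).curvature_add_left
    ((extChartAt 𝓘(ℝ, E) x).map_source hx)]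

lemma curvature_smul (a b c : ℝ) (u v w : TangentSpace 𝓘(ℝ, E) x) :
    S.curvature x (a • u) (b • v) (c • w) = (a * b * c) • S.curvature x u v w := by
  have hx := mem_extChartAt_source (I := 𝓘(ℝ, E)) x
  apply chartDiff_injective hx
  rw [map_smul]
  simp only [S.chartDiff_curvature hx]
  rw [map_smul, map_smul, map_smul, (S.isMetricOn_chartBilin x).curvature_smul
    ((extChartAt 𝓘(ℝ, E) x).map_source hx)]

lemma nablaLorentz_add_left (u v w : TangentSpace 𝓘(ℝ, E) x) :
    S.nablaLorentz x (u + v) w = S.nablaLorentz x u w + S.nablaLorentz x v w := by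
  have hx := mem_extChartAt_source (I := 𝓘(ℝ, E)) x
  apply chartDiff_injective hx
  rw [map_add]
  simp only [S.chartDiff_nablaLorentz hx]
  rw [map_add, LocalGeometry.nablaEnd_add_left]

lemma nablaLorentz_smul (a b : ℝ) (u w : TangentSpace 𝓘(ℝ, E) x) :
    S.nablaLorentz x (a • u) (b • w) = (a * b) • S.nablaLorentz x u w := by
  have hx := mem_extChartAt_source (I := 𝓘(ℝ, E)) x
  apply chartDiff_injective hx
  rw [map_smul]
  simp only [S.chartDiff_nablaLorentz hx]
  rw [map_smul, map_smul, LocalGeometry.nablaEnd_smul_left, LocalGeometry.nablaEnd_smul_right,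
    smul_smul]

lemma inner_nablaLorentz_self (u w : TangentSpace 𝓘(ℝ, E) x) :
    S.metric.inner x (S.nablaLorentz x u w) w = 0 := by
  have hx := mem_extChartAt_source (I := 𝓘(ℝ, E)) x
  have hp := (extChartAt 𝓘(ℝ, E) x).map_source hx
  rw [← chartBilin_extChartAt S.metric.inner hx, S.chartDiff_nablaLorentz hx]
  exact (S.isMetricOn_chartBilin x).nablaEnd_skew hp
    (((S.contDiffOn_chartEnd_lorentz x).contDiffAt
      ((isOpen_extChartAt_target x).mem_nhds hp)).differentiableAt (by simp))
    (fun q hq v w => S.chartEnd_lorentz_skew x hq v w) _ _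

lemma inner_lorentz_self (v : TangentSpace 𝓘(ℝ, E) x) :
    S.metric.inner x v (S.lorentz x v) = 0 := by
  rw [← S.form_eq_inner_lorentz, S.form_self]

variable {x} {s : ℝ}

/-- Nonpositivity of the magnetic sectional curvature, in homogeneous form. -/
lemma inner_curvature_le_of_magneticSec_nonpos (hs : 0 < s)
    (hsec : ∀ (v w : TangentSpace 𝓘(ℝ, E) x),
      S.metric.inner x v v = 1 → S.metric.inner x w w = 1 → S.metric.inner x v w = 0 →
        S.magneticSec s x v w ≤ 0) {X W : TangentSpace 𝓘(ℝ, E) x}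
    (hX : S.metric.inner x X X = s ^ 2) (hXW : S.metric.inner x X W = 0) :
    S.metric.inner x (S.curvature x W X X) W - S.metric.inner x (S.nablaLorentz x W X) W
      + 3 / 4 * (S.metric.inner x W (S.lorentz x X) ^ 2 / s ^ 2)
      + 1 / 4 * S.metric.inner x (S.lorentz x W) (S.lorentz x W) ≤ 0 := by
  by_cases hW : W = 0
  · simp [hW]
  have hpos := S.metric.pos x W hW
  set n := √(S.metric.inner x W W) with hn
  have hn0 : 0 < n := Real.sqrt_pos.2 hpos
  have hnn : S.metric.inner x W W = n ^ 2 := (Real.sq_sqrt hpos.le).symm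
  -- Multiplied by n², the curvature bound for this normalised pair is the claim: the terms along v
  -- pair to zero with W, the (∇_vΩ)(w) term vanishes because ∇_vΩ is skew, and −¼⟨Ω²W,W⟩ = ¼|ΩW|².
  have h := hsec (s⁻¹ • X) (n⁻¹ • W)
    (by simp only [map_smul, smul_apply, smul_eq_mul, hX]; field_simp)
    (by simp only [map_smul, smul_apply, smul_eq_mul, hnn]; field_simp)
    (by simp only [map_smul, smul_apply, smul_eq_mul, hXW]; ring)
  have hskew := S.lorentz_skew x (S.lorentz x W) W
  have h0 := S.inner_nablaLorentz_self x X W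
  simp only [magneticSec, magneticCurvature, curvR, curvA, curvature_smul, nablaLorentz_smul,
    map_smul, map_add, map_sub, add_apply, sub_apply, smul_apply, smul_eq_mul, hXW, h0, hskew] at h
  have h1 : 0 < n ^ 2 := by positivity
  refine (le_of_eq ?_).trans (mul_nonpos_of_nonneg_of_nonpos h1.le h)
  rw [S.metric.symm x (S.lorentz x X) W]
  field_simp
  ring

/-- With K = DJ/dt and D = D²J/dt², the quantity is half the second derivative of |W|², W being the
part of J orthogonal to X. It equals |Y|² − a²/s² minus the curvature terms; their bound costs
¾a²/s² less than the a²/s² to be absorbed, and Cauchy–Schwarz for Y and X pays for the remaining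
quarter. -/
lemma second_variation_nonneg (hs : 0 < s)
    (hsec : ∀ (v w : TangentSpace 𝓘(ℝ, E) x),
      S.metric.inner x v v = 1 → S.metric.inner x w w = 1 → S.metric.inner x v w = 0 →
        S.magneticSec s x v w ≤ 0) {X J K D : TangentSpace 𝓘(ℝ, E) x}
    (hX : S.metric.inner x X X = s ^ 2) (hK : S.metric.inner x K X = 0)
    (hD : D + S.curvature x J X X = S.nablaLorentz x J X + S.lorentz x K)
    (hDX : S.metric.inner x D X + S.metric.inner x K (S.lorentz x X) = 0) :
    0 ≤ S.metric.inner x K K + S.metric.inner x J D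
      - (S.metric.inner x J (S.lorentz x X) ^ 2 + S.metric.inner x J X *
        (S.metric.inner x K (S.lorentz x X) + S.metric.inner x J
          (S.nablaLorentz x X X + S.lorentz x (S.lorentz x X)))) / s ^ 2 := by
  obtain ⟨f, hf⟩ : ∃ f, f = S.metric.inner x J X / s ^ 2 := ⟨_, rfl⟩
  obtain ⟨W, hW⟩ : ∃ W, W = J - f • X := ⟨_, rfl⟩
  have hs2 : s ^ 2 ≠ 0 := by positivity
  have hXW : S.metric.inner x X W = 0 := by
    rw [hW, map_sub, map_smul, hX, S.metric.symm, hf, smul_eq_mul]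
    field_simp
    ring
  have hJ : J = W + f • X := by rw [hW]; abel
  have hle := S.inner_curvature_le_of_magneticSec_nonpos hs hsec hX hXW
  obtain ⟨a, ha⟩ : ∃ a, a = S.metric.inner x W (S.lorentz x X) := ⟨_, rfl⟩
  -- Along the curve, the first three terms are DW/dt; subtracting ½ΩW completes the square.
  obtain ⟨Y, hY⟩ : ∃ Y, Y = K - (a / s ^ 2) • X - f • S.lorentz x X
    - (1 / 2 : ℝ) • S.lorentz x W := ⟨_, rfl⟩
  have hXΩ := S.inner_lorentz_self x X
  have hXΩ' : S.metric.inner x (S.lorentz x X) X = 0 := by rw [S.metric.symm, hXΩ]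
  have hΩW : S.metric.inner x (S.lorentz x W) X = -a := by rw [S.lorentz_skew, ha]
  have hWΩ : S.metric.inner x W (S.lorentz x X) = a := ha.symm
  have hcs := S.inner_sq_le x Y X
  have hYX : S.metric.inner x Y X = -a / 2 := by
    simp only [hY, map_sub, map_smul, sub_apply, smul_apply, smul_eq_mul, hK, hX, hXΩ', hΩW]
    field_simp
    ring
  have hDeq : D = S.nablaLorentz x J X + S.lorentz x K - S.curvature x J X X :=
    eq_sub_of_add_eq hD
  -- The component of J along X drops out of R(J,X)X; in (∇_JΩ)X it leaves f(∇_XΩ)X, which cancels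
  -- at the end against the derivative of ΩX.
  have hR : S.curvature x J X X = S.curvature x W X X := by
    have h1 := S.curvature_smul x f 1 1 X X X
    rw [one_smul, S.curvature_self_left, smul_zero] at h1
    rw [hJ, S.curvature_add_left, h1, add_zero]
  have hN : S.nablaLorentz x J X = S.nablaLorentz x W X + f • S.nablaLorentz x X X := by
    have h1 := S.nablaLorentz_smul x f 1 X X
    rw [one_smul, mul_one] at h1
    rw [hJ, S.nablaLorentz_add_left, h1]
  have hWK : S.metric.inner x W (S.lorentz x K) = -S.metric.inner x (S.lorentz x W) K := by
    rw [S.lorentz_skew, neg_neg]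
  have hWD : S.metric.inner x W D = S.metric.inner x (S.nablaLorentz x W X) W
      + f * S.metric.inner x W (S.nablaLorentz x X X) - S.metric.inner x (S.lorentz x W) K
      - S.metric.inner x (S.curvature x W X X) W := by
    rw [hDeq, hR, hN, S.metric.symm x (S.nablaLorentz x W X), S.metric.symm x (S.curvature x W X X)]
    simp only [map_add, map_sub, map_smul, smul_eq_mul, hWK]
    ring
  have hJD : S.metric.inner x J D = S.metric.inner x W D
      - f * S.metric.inner x K (S.lorentz x X) := by
    rw [hJ, map_add, add_apply, map_smul, smul_apply, smul_eq_mul, S.metric.symm x X D]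
    linear_combination f * hDX
  have hJX : S.metric.inner x J X = f * s ^ 2 := by rw [hf]; field_simp
  have hJΩ : S.metric.inner x J (S.lorentz x X) = a := by
    rw [hJ, map_add, add_apply, map_smul, smul_apply, hXΩ, smul_zero, add_zero, hWΩ]
  have hJN : S.metric.inner x J (S.nablaLorentz x X X)
      = S.metric.inner x W (S.nablaLorentz x X X) := by
    rw [hJ, map_add, add_apply, map_smul, smul_apply, S.metric.symm x X,
      S.inner_nablaLorentz_self, smul_zero, add_zero]
  have hJΩΩ : S.metric.inner x J (S.lorentz x (S.lorentz x X))
      = -S.metric.inner x (S.lorentz x W) (S.lorentz x X)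
        - f * S.metric.inner x (S.lorentz x X) (S.lorentz x X) := by
    rw [hJ, map_add, add_apply, map_smul, smul_apply, S.lorentz_skew x W, S.lorentz_skew x X,
      smul_eq_mul]
    ring
  have hYY : S.metric.inner x Y Y = S.metric.inner x K K
      + f ^ 2 * S.metric.inner x (S.lorentz x X) (S.lorentz x X)
      + 1 / 4 * S.metric.inner x (S.lorentz x W) (S.lorentz x W)
      - 2 * f * S.metric.inner x K (S.lorentz x X) - S.metric.inner x (S.lorentz x W) K
      + f * S.metric.inner x (S.lorentz x W) (S.lorentz x X) := by
    have hXK : S.metric.inner x X K = 0 := by rw [S.metric.symm, hK]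
    have hXW' : S.metric.inner x X (S.lorentz x W) = -a := by rw [S.metric.symm, hΩW]
    simp only [hY, map_sub, map_smul, sub_apply, smul_apply, smul_eq_mul, hX, hXK, hK, hXΩ, hXΩ',
      hΩW, hXW', S.metric.symm x (S.lorentz x X) K, S.metric.symm x K (S.lorentz x W),
      S.metric.symm x (S.lorentz x X) (S.lorentz x W)]
    field_simp
    ring
  rw [hWΩ] at hle
  rw [hYX, hX] at hcs
  -- Cauchy–Schwarz with ⟨Y,X⟩ = −a/2 and |X|² = s².
  have hcs' : a ^ 2 / s ^ 2 / 4 ≤ S.metric.inner x Y Y := by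
    rw [div_div, div_le_iff₀ (by positivity)]
    linarith
  rw [hJD, hWD, map_add, hJN, hJΩ, hJΩΩ, hJX]
  have key : ∀ c : ℝ, (a ^ 2 + f * s ^ 2 * c) / s ^ 2 = a ^ 2 / s ^ 2 + f * c := fun c => by
    field_simp
  rw [key]
  linarith

end MagneticSystem

/-! ### Uniqueness for the magnetic Jacobi equation -/

/-- A solution of a linear differential equation near `t₀` that vanishes once vanishes
identically near `t₀`. -/
lemma eventually_eq_zero_of_linear_ode {F : Type*} [NormedAddCommGroup F] [NormedSpace ℝ F]
    [FiniteDimensional ℝ F] {L : ℝ → F →L[ℝ] F} {y : ℝ → F} {N : Set ℝ} (hN : IsOpen N)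
    (hL : ∀ z, ContinuousOn (fun t => L t z) N) (hy : ∀ t ∈ N, HasDerivAt y (L t (y t)) t)
    {t₀ : ℝ} (ht₀ : t₀ ∈ N) :
    ∃ U ∈ 𝓝 t₀, U ⊆ N ∧ ∀ t₁ ∈ U, ∀ t₂ ∈ U, y t₁ = 0 → y t₂ = 0 := by
  have hLt := (continuousOn_clm_apply.2 hL).continuousAt (hN.mem_nhds ht₀)
  -- Local boundedness of the operator norm gives one Lipschitz constant on a ball, as needed to
  -- compare y with the zero solution.
  have hK : ∀ᶠ t in 𝓝 t₀, ‖L t‖₊ < ‖L t₀‖₊ + 1 :=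
    hLt.nnnorm.eventually_lt_const (lt_add_one _)
  obtain ⟨ε, hε, hball⟩ := Metric.mem_nhds_iff.1 (Filter.inter_mem (hN.mem_nhds ht₀) hK)
  refine ⟨_, Metric.ball_mem_nhds t₀ hε, fun t ht => (hball ht).1, fun t₁ h₁ t₂ h₂ h0 => ?_⟩
  rw [Real.ball_eq_Ioo] at hball h₁ h₂
  exact ODE_solution_unique_of_mem_Ioo (v := fun t z => L t z) (s := fun _ => univ) (g := fun _ => 0)
    (K := ‖L t₀‖₊ + 1)
    (fun t ht => ((L t).lipschitz.weaken (hball ht).2.le).lipschitzOnWith) h₁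
    (fun t ht => ⟨hy t (hball ht).1, mem_univ _⟩)
    (fun t ht => ⟨by simpa using hasDerivAt_const t (0 : F), mem_univ _⟩) h0 h₂

namespace LocalGeometry

variable {E : Type*} [NormedAddCommGroup E] [NormedSpace ℝ E]
  {G : E → E →L[ℝ] E →L[ℝ] ℝ} {U : Set E} {p : E}

/-- The Jacobi operator `u ↦ R(u, v) v`, as a continuous linear map. -/
def jacobiCLM (G : E → E →L[ℝ] E →L[ℝ] ℝ) (p v : E) : E →L[ℝ] E :=
  ((fderiv ℝ (christoffelCLM G) p).flip v).flip v - (fderiv ℝ (christoffelCLM G) p v).flip v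
    + (christoffelCLM G p).flip (christoffelCLM G p v v)
    - (christoffelCLM G p v).comp ((christoffelCLM G p).flip v)

lemma IsMetricOn.jacobiCLM_apply [CompleteSpace E] (h : IsMetricOn G U) (hp : p ∈ U) (u v : E) :
    jacobiCLM G p v u = curvature G p u v v := by
  rw [h.curvature_eq hp]
  simp [jacobiCLM]

/-- The map `u ↦ (∇_u A)(v)`, as a continuous linear map. -/
def nablaEndCLM (G : E → E →L[ℝ] E →L[ℝ] ℝ) (A : E → E →L[ℝ] E) (p v : E) : E →L[ℝ] E :=
  (fderiv ℝ A p).flip v + (christoffelCLM G p).flip (A p v)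
    - (A p).comp ((christoffelCLM G p).flip v)

lemma nablaEndCLM_apply (G : E → E →L[ℝ] E →L[ℝ] ℝ) (A : E → E →L[ℝ] E) (p u v : E) :
    nablaEndCLM G A p v u = nablaEnd G A p u v := by
  simp [nablaEndCLM, nablaEnd, christoffelCLM_apply]

/-- The generator of the magnetic Jacobi equation along a curve through `p` with velocity `v`, as a
first order linear system for the field and its covariant derivative. -/
def jacobiSystem (G : E → E →L[ℝ] E →L[ℝ] ℝ) (A : E → E →L[ℝ] E) (p v : E) : E × E →L[ℝ] E × E :=
  (ContinuousLinearMap.snd ℝ E E - (christoffelCLM G p v).comp (ContinuousLinearMap.fst ℝ E E)).prod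
    ((nablaEndCLM G A p v - jacobiCLM G p v).comp (ContinuousLinearMap.fst ℝ E E)
      + (A p - christoffelCLM G p v).comp (ContinuousLinearMap.snd ℝ E E))

lemma IsMetricOn.continuousOn_jacobiSystem [CompleteSpace E] (h : IsMetricOn G U)
    {A : E → E →L[ℝ] E} (hA : ContDiffOn ℝ ∞ A U) {N : Set ℝ} {c v : ℝ → E}
    (hc : ContinuousOn c N) (hv : ContinuousOn v N) (hcU : MapsTo c N U) (z : E × E) :
    ContinuousOn (fun t => jacobiSystem G A (c t) (v t) z) N := by
  have h1 := h.contDiffOn_christoffelCLM.continuousOn.comp hc hcU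
  have h2 := (h.contDiffOn_christoffelCLM.continuousOn_fderiv_of_isOpen h.isOpen (by simp)).comp
    hc hcU
  have h3 := hA.continuousOn.comp hc hcU
  have h4 := (hA.continuousOn_fderiv_of_isOpen h.isOpen (by simp)).comp hc hcU
  simp only [jacobiSystem, jacobiCLM, nablaEndCLM, ContinuousLinearMap.prod_apply,
    ContinuousLinearMap.comp_apply, add_apply, sub_apply, ContinuousLinearMap.flip_apply,
    ContinuousLinearMap.coe_fst', ContinuousLinearMap.coe_snd']
  have hz1 : ContinuousOn (fun _ : ℝ => z.1) N := continuousOn_const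
  have hz2 : ContinuousOn (fun _ : ℝ => z.2) N := continuousOn_const
  have hΓz := h1.clm_apply hz1
  have hΓv := h1.clm_apply hv
  exact (hz2.sub (hΓv.clm_apply hz1)).prodMk
    ((((((h4.clm_apply hz1).clm_apply hv).add (hΓz.clm_apply (h3.clm_apply hv))).sub
      (h3.clm_apply (hΓz.clm_apply hv))).sub
      ((((((h2.clm_apply hz1).clm_apply hv).clm_apply hv).sub
        (((h2.clm_apply hv).clm_apply hz1).clm_apply hv)).add
        (hΓz.clm_apply (hΓv.clm_apply hv))).sub (hΓv.clm_apply (hΓz.clm_apply hv)))).add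
      ((h3.clm_apply hz2).sub (hΓv.clm_apply hz2)))

end LocalGeometry

namespace MagneticSystem

variable {E : Type*} [NormedAddCommGroup E] [NormedSpace ℝ E] [FiniteDimensional ℝ E]
  {M : Type*} [TopologicalSpace M] [ChartedSpace E M] [IsManifold 𝓘(ℝ, E) ∞ M]
  (S : MagneticSystem E M) {γ : ℝ → M} {I : Set ℝ} {J : ∀ t : ℝ, TangentSpace 𝓘(ℝ, E) (γ t)}

lemma eventually_eq_zero_of_isJacobiOn (hI : IsOpen I)
    (hγ : ContMDiffOn 𝓘(ℝ, ℝ) 𝓘(ℝ, E) ∞ γ I) (hJ : S.IsJacobiOn γ I J) {t₀ : ℝ} (ht₀ : t₀ ∈ I) :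
    ∃ U ∈ 𝓝 t₀, U ⊆ I ∧ ∀ t₁ ∈ U, ∀ t₂ ∈ U, J t₁ = 0 ∧ S.covDeriv γ J t₁ = 0 →
      J t₂ = 0 ∧ S.covDeriv γ J t₂ = 0 := by
  have hJs := IsSmoothAlong.of_contMDiffOn hJ.smooth
  have hKs := S.isSmoothAlong_covDeriv hI hγ hJs
  set x := γ t₀
  set N := I ∩ γ ⁻¹' (extChartAt 𝓘(ℝ, E) x).source
  have hN : IsOpen N := isOpen_curve_preimage hI hγ.continuousOn x
  have htN : t₀ ∈ N := ⟨ht₀, mem_extChartAt_source x⟩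
  have hG := S.isMetricOn_chartBilin x
  have hc := contDiffOn_extChartAt_curve hγ x
  have hcN : MapsTo (fun r => extChartAt 𝓘(ℝ, E) x (γ r)) N (extChartAt 𝓘(ℝ, E) x).target :=
    fun t ht => (extChartAt 𝓘(ℝ, E) x).map_source ht.2
  have hode : ∀ t ∈ N, HasDerivAt
      (fun t => (chartDiff x (γ t) (J t), chartDiff x (γ t) (S.covDeriv γ J t)))
      (LocalGeometry.jacobiSystem (chartBilin S.metric.inner x) (chartEnd S.lorentz x)
        (extChartAt 𝓘(ℝ, E) x (γ t)) (deriv (fun r => extChartAt 𝓘(ℝ, E) x (γ r)) t)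
        (chartDiff x (γ t) (J t), chartDiff x (γ t) (S.covDeriv γ J t))) t := by
    intro t ht
    have h1 := S.chartDiff_covDeriv_of_isSmoothAlong hI hγ hJs ht.1 ht.2
    have h2 := S.chartDiff_covDeriv_of_isSmoothAlong hI hγ hKs ht.1 ht.2
    -- The Jacobi equation, solved for the second covariant derivative, makes the components of (J,
    -- DJ/dt) a first order linear system in the fixed chart at γ t₀.
    rw [eq_sub_of_add_eq (hJ.equation t ht.1), map_sub, map_add, S.chartDiff_nablaLorentz ht.2,
      S.chartDiff_curvature ht.2, ← chartEnd_extChartAt S.lorentz ht.2,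
      chartDiff_velocity hI hγ ht.1 ht.2] at h2
    refine ((hJs.differentiableAt hI hγ.continuousOn ht.1 ht.2).hasDerivAt.prodMk
      (hKs.differentiableAt hI hγ.continuousOn ht.1 ht.2).hasDerivAt).congr_deriv ?_
    rw [eq_comm, ← eq_sub_iff_add_eq] at h1 h2
    rw [h1, h2]
    simp only [LocalGeometry.jacobiSystem, ContinuousLinearMap.prod_apply,
      ContinuousLinearMap.comp_apply, add_apply, sub_apply, ContinuousLinearMap.coe_fst',
      ContinuousLinearMap.coe_snd', hG.jacobiCLM_apply (hcN ht), LocalGeometry.nablaEndCLM_apply,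
      LocalGeometry.christoffelCLM_apply]
    congr 1
    abel
  obtain ⟨U, hU, hUN, hU0⟩ := eventually_eq_zero_of_linear_ode hN
    (hG.continuousOn_jacobiSystem (S.contDiffOn_chartEnd_lorentz x) hc.continuousOn
      (hc.continuousOn_deriv_of_isOpen hN (by simp)) hcN) hode htN
  refine ⟨U, hU, hUN.trans inter_subset_left, fun t₁ h₁ t₂ h₂ h0 => ?_⟩
  have h := hU0 t₁ h₁ t₂ h₂ (by simp [h0.1, h0.2])
  have hinj := chartDiff_injective (E := E) (hUN h₂).2
  exact ⟨hinj ((congrArg Prod.fst h).trans (map_zero _).symm),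
    hinj ((congrArg Prod.snd h).trans (map_zero _).symm)⟩

/-- A magnetic Jacobi field which vanishes together with its covariant derivative at some time
vanishes identically. -/
lemma eq_zero_of_isJacobiOn (hI : IsOpen I) (hIc : I.OrdConnected)
    (hγ : ContMDiffOn 𝓘(ℝ, ℝ) 𝓘(ℝ, E) ∞ γ I) (hJ : S.IsJacobiOn γ I J) {t₁ t₂ : ℝ} (h₁ : t₁ ∈ I)
    (h₂ : t₂ ∈ I) (h0 : J t₁ = 0) (h0' : S.covDeriv γ J t₁ = 0) : J t₂ = 0 := by
  -- Vanishing of the pair (J, DJ/dt) passes locally between times in both directions, hence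
  -- throughout the connected set I.
  refine (hIc.isPreconnected.induction₂' (fun a b => J a = 0 ∧ S.covDeriv γ J a = 0 →
    J b = 0 ∧ S.covDeriv γ J b = 0) (fun t ht => ?_) (fun a b c _ _ _ hab hbc => hbc ∘ hab)
    h₁ h₂ ⟨h0, h0'⟩).1
  obtain ⟨U, hU, -, hU0⟩ := S.eventually_eq_zero_of_isJacobiOn hI hγ hJ ht
  filter_upwards [mem_nhdsWithin_of_mem_nhds hU] with r hr
  exact ⟨hU0 t (mem_of_mem_nhds hU) r hr, hU0 r hr t (mem_of_mem_nhds hU)⟩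

end MagneticSystem

/-! ### Convexity of the normal component -/

namespace MagneticSystem

variable {E : Type*} [NormedAddCommGroup E] [NormedSpace ℝ E] [FiniteDimensional ℝ E]
  {M : Type*} [TopologicalSpace M] [ChartedSpace E M] [IsManifold 𝓘(ℝ, E) ∞ M]
  (S : MagneticSystem E M) {γ : ℝ → M} {I : Set ℝ} {J : ∀ t : ℝ, TangentSpace 𝓘(ℝ, E) (γ t)}
  {s : ℝ}

lemma hasDerivAt_inner_velocity (hI : IsOpen I) (hγ : S.IsGeodesicOn γ I)
    (hJs : IsSmoothAlong γ I J) (hJn : S.IsNormalOn γ I J) {t : ℝ} (ht : t ∈ I) :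
    HasDerivAt (fun r => S.metric.inner (γ r) (J r) (velocity γ r))
      (S.metric.inner (γ t) (J t) (S.lorentz (γ t) (velocity γ t))) t := by
  have h := S.hasDerivAt_inner hI hγ.smooth hJs (IsSmoothAlong.velocity hI hγ.smooth) ht
  rwa [hJn t ht, zero_add, hγ.equation t ht] at h

/-- The squared length of the component orthogonal to the velocity of a normal magnetic Jacobi
field is a convex function, provided that the magnetic sectional curvature is nonpositive. -/
lemma convexOn_normal_component (hs : 0 < s)
    (hsec : ∀ (x : M) (v w : TangentSpace 𝓘(ℝ, E) x),
      S.metric.inner x v v = 1 → S.metric.inner x w w = 1 → S.metric.inner x v w = 0 →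
        S.magneticSec s x v w ≤ 0) (hI : IsOpen I) (hIc : I.OrdConnected)
    (hγ : S.IsGeodesicOn γ I)
    (hspeed : ∀ t ∈ I, S.metric.inner (γ t) (velocity γ t) (velocity γ t) = s ^ 2)
    (hJ : S.IsJacobiOn γ I J) (hJn : S.IsNormalOn γ I J) :
    ConvexOn ℝ I (fun t => S.metric.inner (γ t) (J t) (J t)
      - S.metric.inner (γ t) (J t) (velocity γ t) ^ 2 / s ^ 2) := by
  have hX : IsSmoothAlong (E := E) γ I (velocity γ) := IsSmoothAlong.velocity hI hγ.smooth
  have hΩX := S.isSmoothAlong_lorentz hγ.smooth hX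
  have hJs := IsSmoothAlong.of_contMDiffOn hJ.smooth
  have hKs := S.isSmoothAlong_covDeriv hI hγ.smooth hJs
  have hJX : ∀ t ∈ I, HasDerivAt (fun r => S.metric.inner (γ r) (J r) (velocity γ r))
      (S.metric.inner (γ t) (J t) (S.lorentz (γ t) (velocity γ t))) t := fun t ht =>
    S.hasDerivAt_inner_velocity hI hγ hJs hJn ht
  have hJΩ := fun t (ht : t ∈ I) => S.hasDerivAt_inner hI hγ.smooth hJs hΩX ht
  -- The derivative of the normality condition ⟨DJ/dt, γ'⟩ = 0, with Dγ'/dt = Ω(γ').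
  have hDX : ∀ t ∈ I, S.metric.inner (γ t) (S.covDeriv γ (S.covDeriv γ J) t) (velocity γ t)
      + S.metric.inner (γ t) (S.covDeriv γ J t) (S.lorentz (γ t) (velocity γ t)) = 0 := by
    intro t ht
    have h1 := S.hasDerivAt_inner hI hγ.smooth hKs hX ht
    rw [hγ.equation t ht] at h1
    refine h1.unique ((hasDerivAt_const t (0 : ℝ)).congr_of_eventuallyEq ?_)
    filter_upwards [hI.mem_nhds ht] with r hr using hJn r hr
  have hd1 : ∀ t ∈ I, HasDerivAt (fun t => S.metric.inner (γ t) (J t) (J t)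
      - S.metric.inner (γ t) (J t) (velocity γ t) ^ 2 / s ^ 2)
      (2 * (S.metric.inner (γ t) (J t) (S.covDeriv γ J t)
        - S.metric.inner (γ t) (J t) (velocity γ t)
          * S.metric.inner (γ t) (J t) (S.lorentz (γ t) (velocity γ t)) / s ^ 2)) t := by
    intro t ht
    refine ((S.hasDerivAt_inner hI hγ.smooth hJs hJs ht).sub
      (((hJX t ht).pow 2).div_const _)).congr_deriv ?_
    rw [S.metric.symm (γ t) (S.covDeriv γ J t)]
    push_cast
    ring
  have hd2 : ∀ t ∈ I, HasDerivAt (fun t => 2 * (S.metric.inner (γ t) (J t) (S.covDeriv γ J t)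
        - S.metric.inner (γ t) (J t) (velocity γ t)
          * S.metric.inner (γ t) (J t) (S.lorentz (γ t) (velocity γ t)) / s ^ 2)) _ t :=
    fun t ht => ((S.hasDerivAt_inner hI hγ.smooth hJs hKs ht).sub
      (((hJX t ht).mul (hJΩ t ht)).div_const _)).const_mul 2
  refine convexOn_of_hasDerivWithinAt2_nonneg hIc.convex
    (fun t ht => (hd1 t ht).continuousAt.continuousWithinAt)
    (fun t ht => (hd1 t (interior_subset ht)).hasDerivWithinAt)
    (fun t ht => (hd2 t (interior_subset ht)).hasDerivWithinAt) fun t ht' => ?_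
  have ht := interior_subset ht'
  have h := S.second_variation_nonneg hs (hsec (γ t)) (hspeed t ht) (hJn t ht)
    (hJ.equation t ht) (hDX t ht)
  rw [S.covDeriv_lorentz hI hγ.smooth hX ht, hγ.equation t ht]
  refine mul_nonneg zero_le_two (h.trans_eq ?_)
  ring

/-- If the component orthogonal to the velocity of a normal magnetic Jacobi field vanishes on an
interval at one point of which the field vanishes, then the field vanishes on that interval. -/
lemma eq_zero_of_normal_component_eq_zero (hs : 0 < s) (hI : IsOpen I)
    (hγ : S.IsGeodesicOn γ I)
    (hspeed : ∀ t ∈ I, S.metric.inner (γ t) (velocity γ t) (velocity γ t) = s ^ 2)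
    (hJs : IsSmoothAlong γ I J) (hJn : S.IsNormalOn γ I J) {A : Set ℝ} (hA : Convex ℝ A)
    (hAI : A ⊆ I) {t₀ : ℝ} (ht₀ : t₀ ∈ A) (h0 : J t₀ = 0)
    (hperp : ∀ t ∈ A, S.metric.inner (γ t) (J t) (J t)
      - S.metric.inner (γ t) (J t) (velocity γ t) ^ 2 / s ^ 2 = 0) {t : ℝ} (ht : t ∈ A) :
    J t = 0 := by
  have hs2 : s ^ 2 ≠ 0 := by positivity
  have hpar : ∀ t ∈ A, J t = (S.metric.inner (γ t) (J t) (velocity γ t) / s ^ 2) • velocity γ t := by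
    intro t ht
    -- The squared norm of the difference is the normal component, zero by `hperp`.
    refine sub_eq_zero.1 (S.eq_zero_of_inner_self (γ t) ?_)
    have h1 := hperp t ht
    simp only [map_sub, map_smul, sub_apply, smul_apply, smul_eq_mul, hspeed t (hAI ht),
      S.metric.symm (γ t) (velocity γ t) (J t)]
    field_simp at h1 ⊢
    linear_combination h1
  have hderiv : ∀ t ∈ A, HasDerivWithinAt (fun r => S.metric.inner (γ r) (J r) (velocity γ r))
      0 A t := by
    intro t ht
    refine ((S.hasDerivAt_inner_velocity hI hγ hJs hJn (hAI ht)).congr_deriv ?_).hasDerivWithinAt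
    -- J is parallel to γ' and ⟨γ', Ωγ'⟩ = 0, so ⟨J, γ'⟩ has zero derivative on A.
    rw [hpar t ht, map_smul, smul_apply, S.inner_lorentz_self, smul_zero]
  have hconst := hA.norm_image_sub_le_of_norm_hasDerivWithin_le (C := 0) hderiv (by simp) ht₀ ht
  rw [zero_mul, norm_le_zero_iff, h0, map_zero, zero_apply, sub_zero] at hconst
  rw [hpar t ht, hconst, zero_div, zero_smul]

end MagneticSystem

end

theorem proposition3p2
    {E : Type*} [NormedAddCommGroup E] [NormedSpace ℝ E] [FiniteDimensional ℝ E]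
    {M : Type*} [TopologicalSpace M] [ChartedSpace E M] [IsManifold 𝓘(ℝ, E) ∞ M]
    (S : MagneticSystem E M) (s : ℝ) (hs : 0 < s)
    (hsec : ∀ (x : M) (v w : TangentSpace 𝓘(ℝ, E) x),
      S.metric.inner x v v = 1 → S.metric.inner x w w = 1 → S.metric.inner x v w = 0 →
        S.magneticSec s x v w ≤ 0) :
    S.WithoutConjugatePoints s := by
  rintro γ I hI hIc h0 hγ hspeed' τ hτ hτ0 ⟨J, hJ, hJn, ⟨t, ht, htJ⟩, hJ0, c, hJτ⟩
  have hspeed : ∀ t ∈ I, S.metric.inner (γ t) (velocity γ t) (velocity γ t) = s ^ 2 := by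
    intro t ht
    rw [← hspeed' t ht, Real.sq_sqrt (S.inner_self_nonneg _ _)]
  have hs2 : s ^ 2 ≠ 0 := by positivity
  have hJs := IsSmoothAlong.of_contMDiffOn hJ.smooth
  have hconv := S.convexOn_normal_component hs hsec hI hIc hγ hspeed hJ hJn
  have hA : segment ℝ 0 τ ⊆ I := hIc.convex.segment_subset h0 hτ
  have hperp : ∀ t ∈ segment ℝ 0 τ, S.metric.inner (γ t) (J t) (J t)
      - S.metric.inner (γ t) (J t) (velocity γ t) ^ 2 / s ^ 2 = 0 := by
    intro t ht
    -- Convexity bounds the function by its larger end value; both are zero, as J(0) = 0 and J(τ) is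
    -- a multiple of γ'(τ). The lower bound is Cauchy–Schwarz.
    refine le_antisymm ((hconv.le_on_segment h0 hτ ht).trans (max_le ?_ ?_)) ?_
    · simp [hJ0]
    · simp only [hJτ, map_smul, smul_apply, smul_eq_mul, hspeed τ hτ]
      field_simp
      simp
    · have h := S.inner_sq_le (γ t) (J t) (velocity γ t)
      rw [hspeed t (hA ht)] at h
      rw [sub_nonneg, div_le_iff₀ (by positivity)]
      exact h
  have hzero : ∀ t ∈ segment ℝ 0 τ, J t = 0 := fun t ht =>
    S.eq_zero_of_normal_component_eq_zero hs hI hγ hspeed hJs hJn (convex_segment 0 τ) hA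
      (left_mem_segment ℝ 0 τ) hJ0 hperp ht
  -- At an interior time of the segment, for either sign of τ, J vanishes on a neighbourhood, so
  -- DJ/dt vanishes there too and the uniqueness lemma applies.
  have hmem : segment ℝ 0 τ ∈ 𝓝 (τ / 2) := by
    rw [segment_eq_uIcc]
    rcases hτ0.lt_or_gt with h | h
    · rw [uIcc_of_ge h.le]
      exact Icc_mem_nhds (by linarith) (by linarith)
    · rw [uIcc_of_le h.le]
      exact Icc_mem_nhds (by linarith) (by linarith)
  have hmid := hA (mem_of_mem_nhds hmem)
  have hmid0 := hzero _ (mem_of_mem_nhds hmem)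
  refine htJ (S.eq_zero_of_isJacobiOn hI hIc hγ.smooth hJ hmid ht hmid0 ?_)
  have hx := mem_extChartAt_source (I := 𝓘(ℝ, E)) (γ (τ / 2))
  apply chartDiff_injective hx
  have hev : (fun r => chartDiff (γ (τ / 2)) (γ r) (J r)) =ᶠ[𝓝 (τ / 2)] fun _ => (0 : E) := by
    filter_upwards [hmem] with r hr
    rw [hzero r hr, map_zero]
  rw [S.chartDiff_covDeriv_of_isSmoothAlong hI hγ.smooth hJs hmid hx, hev.deriv_eq, hmid0, map_zero,
    ← LocalGeometry.christoffelCLM_apply, map_zero, deriv_const, add_zero]
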